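/- There is an absolute constant $c>0$ (in particular, independent of $H$) such that the following holds. Let $d\ge 1$, $A\in\mathbb R^{d\times d}$, $\xi\in\mathbb R^d$ and $H\in(0,\tfrac12)$. Let $B^H=(B^{H,1},\dots,B^{H,d})$ be a $d$-dimensional fractional Brownian motion on $[0,1]$ with Hurst parameter $H$, i.e. its components are independent centered Gaussian processes with covariance $\mathbb E[B^{H,i}_tB^{H,i}_s]=\tfrac12\left(|t|^{2H}+|s|^{2H}-|t-s|^{2H}\right)$. Let $X^H$ be a $d$-dimensional fractional Ornstein–Uhlenbeck process solving $$dX^H_t=AX^H_t\,dt+dB^H_t,\qquad X^H_0=\xi,$$ i.e. almost surely $X^H$ has continuous paths on $[0,1]$ and $X^H_t=\xi+\int_0^tAX^H_s\,ds+B^H_t$ for all $t\in[0,1]$. Denote by $a_{ij}(t)$ the entries of the matrix $\exp(tA)A$ and assume that there are $i_0\in\{1,\dots,d\}$ and $0<C_1<1$ with $\min_{t\in[0,1]}a_{i_0i_0}(t)\ge -1+C_1$. Then each $X^H_t$, $t\in[0,1]$, is integrable, and $$\mathbb E\left[\sup_{t\in[0,1]}\left\|X^H_t-\mathbb E[X^H_t]\right\|\right]\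 \ge\ c\,e^{-1/2}\sqrt{\frac1H\log\left(\frac{2C_1}{e^{-1/2}}\right)},$$ where $\|\cdot\|$ is the Euclidean norm and the square root is read as $0$ when the logarithm is negative. -/

import Mathlib

open MeasureTheory ProbabilityTheory Set

/-- `B` is a (one-dimensional) fractional Brownian motion with Hurst parameter `H` on `[0, T]`:
a centered Gaussian process with covariance `(|t|^{2H} + |s|^{2H} - |t - s|^{2H}) / 2`.
Only the values `B t` with `t ∈ [0, T]` matter. -/
structure IsFractionalBrownianMotion {Ω : Type*} [MeasurableSpace Ω] (H T : ℝ)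
    (B : ℝ → Ω → ℝ) (P : Measure Ω) : Prop where
  isGaussianProcess : IsGaussianProcess (fun t : Icc (0 : ℝ) T ↦ B t) P
  centered : ∀ t ∈ Icc (0 : ℝ) T, ∫ ω, B t ω ∂P = 0
  covariance : ∀ t ∈ Icc (0 : ℝ) T, ∀ s ∈ Icc (0 : ℝ) T,
    ∫ ω, B t ω * B s ω ∂P
      = (1 / 2) * (|t| ^ (2 * H) + |s| ^ (2 * H) - |t - s| ^ (2 * H))

/-- `B` is a `d`-dimensional fractional Brownian motion with Hurst parameter `H` on `[0, T]`:
its components are independent one-dimensional fractional Brownian motions. -/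
structure IsFractionalBrownianMotionVec {Ω : Type*} [MeasurableSpace Ω] (H T : ℝ) {d : ℕ}
    (B : ℝ → Ω → EuclideanSpace ℝ (Fin d)) (P : Measure Ω) : Prop where
  component : ∀ i : Fin d, IsFractionalBrownianMotion H T (fun t ω ↦ B t ω i) P
  independent : iIndepFun (fun (i : Fin d) (ω : Ω) (t : Icc (0 : ℝ) T) ↦ B t ω i) P

/-- `X` is a `d`-dimensional fractional Ornstein-Uhlenbeck process on `[0, T]` driven by `B`, i.e.
a solution of `dX_t = A X_t dt + dB_t`, `X_0 = ξ`: almost surely, the path of `X` is continuous on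
`[0, T]` and `X_t = ξ + ∫_0^t A X_s ds + B_t` for all `t ∈ [0, T]`. -/
def IsFractionalOU {Ω : Type*} [MeasurableSpace Ω] (T : ℝ) {d : ℕ}
    (A : Matrix (Fin d) (Fin d) ℝ) (ξ : EuclideanSpace ℝ (Fin d))
    (B X : ℝ → Ω → EuclideanSpace ℝ (Fin d)) (P : Measure Ω) : Prop :=
  ∀ᵐ ω ∂P, ContinuousOn (fun t ↦ X t ω) (Icc (0 : ℝ) T) ∧
    ∀ t ∈ Icc (0 : ℝ) T,
      X t ω = ξ + (∫ s in (0 : ℝ)..t, Matrix.toEuclideanCLM (𝕜 := ℝ) A (X s ω)) + B t ω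

/-! Sample one coordinate of `X` at the times `i / N`, with `N` about `exp (1 / H)`. Then `N ^ (-H)`
stays above an absolute constant, so if each sample keeps, given the earlier ones, a standard
deviation of order `C * N ^ (-H)`, the maximum should behave like that of `N` independent Gaussians:
of order `C * √(log N)`, that is `C / √H`. This linear bound in `C` dominates the stated one because
`log z ≤ z ^ 2`.

Conditioning successively bounds the probability that all samples lie in shifted intervals `[-r, r]`
by `Φ(r / δ) ^ N` (`measure_forall_abs_add_le_le`), and for `r / δ = 1 / (2 * √H)` this is at most
`exp (-1/2)` (`gaussianReal_Iic_pow_ceil_le`). Markov's inequality then gives the expectation.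

For the conditional variance, variation of constants makes `X` a limit of linear functions of `B` on
finer grids. Summation by parts turns weights on values into tail sums on increments; the assumption
on `exp (tA) A` keeps the relevant tail sums above `1 + (-1 + C) = C`
(`le_sum_discretizationWeight`). Earlier samples cannot touch the increments of the last interval of
length `1 / N`. Since `H < 1/2`, distinct increments are nonpositively correlated, so the variance
dominates a diagonal form given by the row sums of the covariance matrix, which telescope to order
`N ^ (-2 * H)`. -/

/-! ### Gaussian small balls by successive conditioning -/

/-- A centered Gaussian variable with standard deviation at least `δ` is below `r` with probability
at most that of a Gaussian variable with standard deviation `δ`. -/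
lemma HasGaussianLaw.measure_le_le {Ω : Type*} [MeasurableSpace Ω] {P : Measure Ω}
    {R : Ω → ℝ} (hR : HasGaussianLaw R P) (hR0 : ∫ ω, R ω ∂P = 0) {δ r : ℝ} (hδ : 0 < δ)
    (hr : 0 ≤ r) (hvar : δ ^ 2 ≤ Var[R; P]) :
    P {ω | R ω ≤ r} ≤ gaussianReal 0 1 (Iic (r / δ)) := by
  have hpos : 0 < Var[R; P] := lt_of_lt_of_le (by positivity) hvar
  have hσ : 0 < √Var[R; P] := Real.sqrt_pos.2 hpos
  have h1 : P {ω | R ω ≤ r} = P.map R (Iic r) :=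
    (Measure.map_apply_of_aemeasurable hR.aemeasurable measurableSet_Iic).symm
  have h2 : gaussianReal 0 Var[R; P].toNNReal
      = (gaussianReal 0 1).map (fun x ↦ √Var[R; P] * x) := by
    rw [gaussianReal_map_const_mul]
    congr 1
    · simp
    · ext
      simp [Real.sq_sqrt hpos.le, hpos.le]
  rw [h1, hR.map_eq_gaussianReal, hR0, h2, Measure.map_apply (by fun_prop) measurableSet_Iic]
  refine measure_mono fun x hx ↦ ?_
  simp only [mem_preimage, mem_Iic] at hx ⊢
  have h3 : δ ≤ √Var[R; P] := Real.le_sqrt_of_sq_le hvar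
  calc x ≤ r / √Var[R; P] := by rwa [le_div_iff₀ hσ, mul_comm]
    _ ≤ r / δ := by gcongr

/-- Splitting by the sign of `f (V ω)` leaves a one-sided constraint, `R ≤ r` or `R ≥ -r`, which is
independent of `V`. The loss against a two-sided bound is harmless: a single Gaussian tail suffices
later. -/
lemma measure_inter_abs_add_le_le {Ω F : Type*} [MeasurableSpace Ω] [MeasurableSpace F]
    {P : Measure Ω} {V : Ω → F} {R : Ω → ℝ} (hV : AEMeasurable V P)
    (hR : HasGaussianLaw R P) (hR0 : ∫ ω, R ω ∂P = 0) (hind : IndepFun V R P)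
    {δ r : ℝ} (hδ : 0 < δ) (hr : 0 ≤ r) (hvar : δ ^ 2 ≤ Var[R; P])
    {S : Set F} (hS : MeasurableSet S) {f : F → ℝ} (hf : Measurable f) :
    P {ω | V ω ∈ S ∧ |f (V ω) + R ω| ≤ r}
      ≤ P (V ⁻¹' S) * gaussianReal 0 1 (Iic (r / δ)) := by
  have hN : MeasurableSet {x | 0 ≤ f x} := measurableSet_le measurable_const hf
  have hsub : {ω | V ω ∈ S ∧ |f (V ω) + R ω| ≤ r} ⊆
      (V ⁻¹' (S ∩ {x | 0 ≤ f x}) ∩ R ⁻¹' (Iic r)) ∪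
      (V ⁻¹' (S \ {x | 0 ≤ f x}) ∩ R ⁻¹' (Ici (-r))) := by
    rintro ω ⟨h1, h2⟩
    rw [abs_le] at h2
    by_cases h : 0 ≤ f (V ω)
    · exact Or.inl ⟨⟨h1, h⟩, by simp only [mem_preimage, mem_Iic]; linarith⟩
    · exact Or.inr ⟨⟨h1, h⟩, by simp only [mem_preimage, mem_Ici]; push Not at h; linarith⟩
  have hle : P (R ⁻¹' (Iic r)) ≤ gaussianReal 0 1 (Iic (r / δ)) :=
    HasGaussianLaw.measure_le_le hR hR0 hδ hr hvar
  have hge : P (R ⁻¹' (Ici (-r))) ≤ gaussianReal 0 1 (Iic (r / δ)) := by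
    have := HasGaussianLaw.measure_le_le (R := fun ω ↦ -R ω) hR.fun_neg
      (by rw [integral_neg, hR0, neg_zero]) hδ hr (by rwa [variance_fun_neg])
    refine (measure_mono fun ω hω ↦ ?_).trans this
    simp only [mem_preimage, mem_Ici, mem_ofPred_eq] at hω ⊢
    linarith
  have hadd : P (V ⁻¹' (S ∩ {x | 0 ≤ f x})) + P (V ⁻¹' (S \ {x | 0 ≤ f x})) = P (V ⁻¹' S) := by
    rw [← Measure.map_apply_of_aemeasurable hV (hS.inter hN),
      ← Measure.map_apply_of_aemeasurable hV (hS.diff hN),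
      ← Measure.map_apply_of_aemeasurable hV hS, measure_inter_add_sdiff _ hN]
  calc _ ≤ _ := measure_mono hsub
    _ ≤ _ := measure_union_le _ _
    _ = P (V ⁻¹' (S ∩ {x | 0 ≤ f x})) * P (R ⁻¹' (Iic r))
        + P (V ⁻¹' (S \ {x | 0 ≤ f x})) * P (R ⁻¹' (Ici (-r))) := by
      rw [hind.measure_inter_preimage_eq_mul _ _ (hS.inter hN) measurableSet_Iic,
        hind.measure_inter_preimage_eq_mul _ _ (hS.diff hN) measurableSet_Ici]
    _ ≤ P (V ⁻¹' (S ∩ {x | 0 ≤ f x})) * gaussianReal 0 1 (Iic (r / δ))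
        + P (V ⁻¹' (S \ {x | 0 ≤ f x})) * gaussianReal 0 1 (Iic (r / δ)) := by gcongr
    _ = _ := by rw [← add_mul, hadd]

/-- Orthogonal projection of a square integrable variable on finitely many others. -/
lemma exists_integral_sub_sum_mul_eq_zero {Ω ι : Type*} [MeasurableSpace Ω] [Fintype ι]
    {P : Measure Ω} {Z : Ω → ℝ} {Y : ι → Ω → ℝ} (hZ : MemLp Z 2 P) (hY : ∀ i, MemLp (Y i) 2 P) :
    ∃ c : ι → ℝ, ∀ i, ∫ ω, (Z ω - ∑ j, c j * Y j ω) * Y i ω ∂P = 0 := by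
  set K := Submodule.span ℝ (range fun i ↦ (hY i).toLp (Y i)) with hK
  have : FiniteDimensional ℝ K := FiniteDimensional.span_of_finite ℝ (finite_range _)
  obtain ⟨c, hc⟩ := (Submodule.mem_span_range_iff_exists_fun ℝ).1
    (K.starProjection_apply_mem (hZ.toLp Z))
  refine ⟨c, fun i ↦ ?_⟩
  have h := Submodule.starProjection_inner_eq_zero (K := K) (hZ.toLp Z) ((hY i).toLp (Y i))
    (Submodule.subset_span (mem_range_self i))
  rw [← hc] at h
  have hmem : MemLp (fun ω ↦ Z ω - ∑ j, c j * Y j ω) 2 P :=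
    hZ.sub (memLp_finsetSum _ fun j _ ↦ (hY j).const_mul (c j))
  have heq : hZ.toLp Z - ∑ j, c j • (hY j).toLp (Y j)
      = hmem.toLp (fun ω ↦ Z ω - ∑ j, c j * Y j ω) := by
    have hs : ∑ j, c j • (hY j).toLp (Y j) = (memLp_finsetSum Finset.univ
        fun j _ ↦ (hY j).const_mul (c j)).toLp (fun ω ↦ ∑ j, c j * Y j ω) := by
      apply Lp.ext
      refine (Lp.coeFn_fun_finsetSum _ _).trans ?_
      refine Filter.EventuallyEq.trans ?_ (MemLp.coeFn_toLp _).symm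
      have : ∀ᵐ ω ∂P, ∀ j, (c j • (hY j).toLp (Y j) : Lp ℝ 2 P) ω = c j * Y j ω := by
        rw [ae_all_iff]
        intro j
        filter_upwards [Lp.coeFn_smul (c j) ((hY j).toLp (Y j)), (hY j).coeFn_toLp] with ω h1 h2
        rw [h1, Pi.smul_apply, h2, smul_eq_mul]
      filter_upwards [this] with ω hω
      exact Finset.sum_congr rfl fun j _ ↦ hω j
    rw [hs, ← MemLp.toLp_sub]
    rfl
  rw [heq, L2.inner_def] at h
  rw [← h]
  refine integral_congr_ae ?_
  filter_upwards [hmem.coeFn_toLp, (hY i).coeFn_toLp] with ω h1 h2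
  rw [h1, h2]
  simp [mul_comm]

/-- If each of `Y 0, …, Y (N - 1)` has, given the previous ones, a conditional standard deviation
of at least `δ`, then these variables, shifted arbitrarily, are all in `[-r, r]` with probability at
most `Φ(r / δ) ^ N`. -/
theorem measure_forall_abs_add_le_le {Ω : Type*} [MeasurableSpace Ω] {P : Measure Ω} {N : ℕ}
    {Y : ℕ → Ω → ℝ} (hY : HasGaussianLaw (fun ω (i : Fin N) ↦ Y i ω) P)
    (hY0 : ∀ i < N, ∫ ω, Y i ω ∂P = 0) {δ r : ℝ} (hδ : 0 < δ) (hr : 0 ≤ r)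
    (hvar : ∀ i < N, ∀ c : ℕ → ℝ,
      δ ^ 2 ≤ Var[fun ω ↦ Y i ω - ∑ l ∈ Finset.range i, c l * Y l ω; P]) (u : ℕ → ℝ) :
    P {ω | ∀ i < N, |Y i ω + u i| ≤ r} ≤ gaussianReal 0 1 (Iic (r / δ)) ^ N := by
  have := hY.isProbabilityMeasure
  suffices ∀ n ≤ N, P {ω | ∀ i < n, |Y i ω + u i| ≤ r} ≤ gaussianReal 0 1 (Iic (r / δ)) ^ n from
    this N le_rfl
  intro n
  induction n with
  | zero => intro _; simp
  | succ n ih =>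
    intro hn
    have hmem : ∀ i < N, MemLp (Y i) 2 P := fun i hi ↦ (hY.eval ⟨i, hi⟩).memLp_two
    obtain ⟨c, hc⟩ := exists_integral_sub_sum_mul_eq_zero (hmem n hn)
      (Y := fun i : Fin n ↦ Y i) (fun i ↦ hmem i (by omega))
    let c' : ℕ → ℝ := fun i ↦ if h : i < n then c ⟨i, h⟩ else 0
    have hsum : ∀ ω, ∑ j, c j * Y j ω = ∑ l ∈ Finset.range n, c' l * Y l ω := fun ω ↦ by
      rw [Finset.sum_range]
      exact Finset.sum_congr rfl fun j _ ↦ by simp [c']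
    set R : Ω → ℝ := fun ω ↦ Y n ω - ∑ j, c j * Y j ω with hRdef
    set V : Ω → Fin n → ℝ := fun ω i ↦ Y i ω with hVdef
    have hVR : HasGaussianLaw (fun ω ↦ (V ω, R ω)) P := by
      let Lc : (Fin N → ℝ) →L[ℝ] (Fin n → ℝ) × ℝ :=
        (ContinuousLinearMap.pi fun i : Fin n ↦
          ContinuousLinearMap.proj (⟨i, by omega⟩ : Fin N)).prod
        (ContinuousLinearMap.proj (⟨n, hn⟩ : Fin N) -
          ∑ j : Fin n, c j • ContinuousLinearMap.proj (⟨j, by omega⟩ : Fin N))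
      have hLc : (fun ω ↦ (V ω, R ω)) = fun ω ↦ Lc (fun i ↦ Y i ω) := by
        ext ω
        · simp [Lc, hVdef]
        · simp [Lc, hRdef, sum_apply]
      rw [hLc]
      exact hY.map_fun Lc
    have hR0 : ∫ ω, R ω ∂P = 0 := by
      rw [hRdef, integral_sub, integral_finsetSum, hY0 n hn, zero_sub, neg_eq_zero]
      · refine Finset.sum_eq_zero fun j _ ↦ ?_
        rw [integral_const_mul, hY0 j (by omega), mul_zero]
      · exact fun j _ ↦ ((hmem j (by omega)).integrable (by norm_num)).const_mul _
      · exact (hmem n hn).integrable (by norm_num)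
      · exact integrable_finsetSum _ fun j _ ↦
          ((hmem j (by omega)).integrable (by norm_num)).const_mul _
    -- The projection residual is uncorrelated with the earlier variables, hence independent of them
    -- by joint Gaussianity. `Unit` presents `R` as a family, as the criterion requires.
    have hind : IndepFun V R P := by
      have : IndepFun V (fun ω (_ : Unit) ↦ R ω) P := by
        refine HasGaussianLaw.indepFun_of_covariance_eval (X := fun i : Fin n ↦ Y i)
          (Y := fun _ : Unit ↦ R) ?_ fun i _ ↦ ?_
        · let Lp : ((Fin n → ℝ) × ℝ) →L[ℝ] ((Fin n → ℝ) × (Unit → ℝ)) :=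
            (ContinuousLinearMap.fst ℝ (Fin n → ℝ) ℝ).prod
              (ContinuousLinearMap.pi fun _ ↦ ContinuousLinearMap.snd ℝ (Fin n → ℝ) ℝ)
          exact hVR.map_fun Lp
        · rw [covariance_eq_sub (hmem i (by omega)) hVR.snd.memLp_two, hR0, mul_zero, sub_zero,
            ← hc i]
          exact integral_congr_ae (.of_forall fun ω ↦ by simp [hRdef, mul_comm])
      exact this.comp measurable_id (measurable_pi_apply ())
    have hvarR : δ ^ 2 ≤ Var[R; P] := by
      simp only [hRdef, hsum]
      exact hvar n hn c'
    -- Here `f V` is the linear prediction of `Y n` plus the shift, so that `f V + R = Y n + u n`.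
    have key := measure_inter_abs_add_le_le hVR.fst.aemeasurable hVR.snd hR0 hind hδ hr hvarR
      (S := {v | ∀ i : Fin n, |v i + u i| ≤ r})
      (f := fun v ↦ ∑ j, c j * v j + u n)
      (by
        rw [ofPred_forall]
        exact MeasurableSet.iInter fun i ↦ measurableSet_le (by fun_prop) measurable_const)
      (by fun_prop)
    calc P {ω | ∀ i < n + 1, |Y i ω + u i| ≤ r} ≤ _ := measure_mono fun ω hω ↦ ?_
      _ ≤ _ := key
      _ ≤ gaussianReal 0 1 (Iic (r / δ)) ^ n * gaussianReal 0 1 (Iic (r / δ)) := by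
        gcongr
        refine (measure_mono fun ω hω i hi ↦ ?_).trans (ih (by omega))
        exact hω ⟨i, hi⟩
      _ = _ := (pow_succ _ _).symm
    refine ⟨fun i ↦ hω i (by omega), ?_⟩
    have := hω n (by omega)
    simp only [hVdef, hRdef]
    convert this using 2
    ring

/-! ### Variance of Wiener sums for negatively correlated increments -/

/-- A symmetric quadratic form with nonpositive off-diagonal entries dominates the diagonal form
given by its row sums. -/
lemma sum_sq_mul_sum_le_sum_sum {ι : Type*} (s : Finset ι) (ρ : ι → ι → ℝ) (f : ι → ℝ)
    (hsymm : ∀ k l, ρ k l = ρ l k) (hneg : ∀ k l, k ≠ l → ρ k l ≤ 0) :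
    ∑ k ∈ s, f k ^ 2 * ∑ l ∈ s, ρ k l ≤ ∑ k ∈ s, ∑ l ∈ s, f k * f l * ρ k l := by
  have h1 : ∑ k ∈ s, ∑ l ∈ s, (f k ^ 2 + f l ^ 2) / 2 * ρ k l
      = ∑ k ∈ s, f k ^ 2 * ∑ l ∈ s, ρ k l := by
    have h2 : ∑ k ∈ s, ∑ l ∈ s, f l ^ 2 / 2 * ρ k l = ∑ k ∈ s, ∑ l ∈ s, f k ^ 2 / 2 * ρ k l := by
      rw [Finset.sum_comm]
      exact Finset.sum_congr rfl fun k _ ↦ Finset.sum_congr rfl fun l _ ↦ by rw [hsymm]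
    simp only [add_div, add_mul, Finset.sum_add_distrib, h2]
    rw [← Finset.sum_add_distrib]
    refine Finset.sum_congr rfl fun k _ ↦ ?_
    rw [← Finset.mul_sum]
    ring
  rw [← h1]
  -- Off the diagonal, `f k * f l ≤ (f k ^ 2 + f l ^ 2) / 2` is reversed by the factor `ρ k l ≤ 0`.
  refine Finset.sum_le_sum fun k _ ↦ Finset.sum_le_sum fun l _ ↦ ?_
  by_cases h : k = l
  · subst h
    exact le_of_eq (by ring)
  · nlinarith [sq_nonneg (f k - f l), hneg k l h]

lemma rpow_add_rpow_le_two_mul_rpow {p x : ℝ} (hp0 : 0 ≤ p) (hp1 : p ≤ 1) (hx : 1 ≤ x) :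
    (x + 1) ^ p + (x - 1) ^ p ≤ 2 * x ^ p := by
  have h := (Real.concaveOn_rpow hp0 hp1).2 (mem_Ici.2 (by linarith : 0 ≤ x + 1))
    (mem_Ici.2 (by linarith : 0 ≤ x - 1)) (by norm_num : (0 : ℝ) ≤ 1 / 2)
    (by norm_num : (0 : ℝ) ≤ 1 / 2) (by norm_num)
  simp only [smul_eq_mul] at h
  rw [show 1 / 2 * (x + 1) + 1 / 2 * (x - 1) = x by ring] at h
  linarith

/-- With `p = 2 * H` this is, up to a positive factor, the covariance of two distinct grid
increments; its sign comes from concavity of `x ^ p`. -/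
lemma abs_rpow_second_difference_nonpos {p : ℝ} (hp0 : 0 ≤ p) (hp1 : p ≤ 1) {k l : ℕ}
    (hkl : k ≠ l) :
    |(k : ℝ) + 1 - l| ^ p + |(k : ℝ) - (l + 1)| ^ p - 2 * |(k : ℝ) - l| ^ p ≤ 0 := by
  rcases lt_or_gt_of_ne hkl with h | h
  · have h' : (k : ℝ) + 1 ≤ l := by exact_mod_cast h
    rw [abs_of_nonpos (by linarith), abs_of_nonpos (by linarith), abs_of_nonpos (by linarith)]
    have := rpow_add_rpow_le_two_mul_rpow hp0 hp1 (x := (l : ℝ) - k) (by linarith)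
    rw [show -((k : ℝ) + 1 - l) = l - k - 1 by ring, show -((k : ℝ) - (l + 1)) = l - k + 1 by ring,
      show -((k : ℝ) - l) = l - k by ring]
    linarith
  · have h' : (l : ℝ) + 1 ≤ k := by exact_mod_cast h
    rw [abs_of_nonneg (by linarith), abs_of_nonneg (by linarith), abs_of_nonneg (by linarith)]
    have := rpow_add_rpow_le_two_mul_rpow hp0 hp1 (x := (k : ℝ) - l) (by linarith)
    rw [show (k : ℝ) + 1 - l = k - l + 1 by ring, show (k : ℝ) - (l + 1) = k - l - 1 by ring]
    linarith

namespace IsFractionalBrownianMotion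

variable {Ω : Type*} [MeasurableSpace Ω] {P : Measure Ω} {H T : ℝ} {B : ℝ → Ω → ℝ}

lemma hasGaussianLaw (hB : IsFractionalBrownianMotion H T B P) {t : ℝ} (ht : t ∈ Icc 0 T) :
    HasGaussianLaw (B t) P :=
  hB.isGaussianProcess.hasGaussianLaw_eval ⟨t, ht⟩

lemma integral_sq (hB : IsFractionalBrownianMotion H T B P) (hH : 0 < H) {t : ℝ}
    (ht : t ∈ Icc 0 T) : ∫ ω, B t ω ^ 2 ∂P = t ^ (2 * H) := by
  have := hB.covariance t ht t ht
  simp only [sub_self, abs_zero] at this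
  rw [Real.zero_rpow (by positivity), abs_of_nonneg ht.1] at this
  simp only [sq, this]
  ring

lemma zero_ae_eq (hB : IsFractionalBrownianMotion H T B P) (hH : 0 < H) (hT : 0 ≤ T) :
    B 0 =ᵐ[P] 0 := by
  have h0 : (0 : ℝ) ∈ Icc 0 T := ⟨le_rfl, hT⟩
  have := hB.integral_sq hH h0
  rw [Real.zero_rpow (by positivity), integral_eq_zero_iff_of_nonneg (fun _ ↦ sq_nonneg _)
    (hB.hasGaussianLaw h0).memLp_two.integrable_sq] at this
  filter_upwards [this] with ω hω
  simpa using hω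

lemma div_mem_Icc {k M : ℕ} (hkM : k ≤ M) : (k : ℝ) / M ∈ Icc (0 : ℝ) 1 :=
  ⟨by positivity, div_le_one_of_le₀ (by exact_mod_cast hkM) (by positivity)⟩

lemma covariance_grid (hB : IsFractionalBrownianMotion H 1 B P) {M k l : ℕ}
    (hk : k ≤ M) (hl : l ≤ M) :
    ∫ ω, B (k / M) ω * B (l / M) ω ∂P = 1 / 2 / (M : ℝ) ^ (2 * H)
      * (|(k : ℝ)| ^ (2 * H) + |(l : ℝ)| ^ (2 * H) - |(k : ℝ) - l| ^ (2 * H)) := by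
  rw [hB.covariance _ (div_mem_Icc hk) _ (div_mem_Icc hl), ← sub_div]
  simp only [abs_div, Nat.abs_cast]
  rw [Real.div_rpow (by positivity) (by positivity), Real.div_rpow (by positivity) (by positivity),
    Real.div_rpow (by positivity) (by positivity)]
  ring

lemma integral_increment_mul_increment (hB : IsFractionalBrownianMotion H 1 B P) {M k l : ℕ}
    (hk : k < M) (hl : l < M) :
    ∫ ω, (B ((k + 1 : ℕ) / M) ω - B (k / M) ω) * (B ((l + 1 : ℕ) / M) ω - B (l / M) ω) ∂P
      = 1 / 2 / (M : ℝ) ^ (2 * H) * (|(k : ℝ) + 1 - l| ^ (2 * H) + |(k : ℝ) - (l + 1)| ^ (2 * H)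
        - 2 * |(k : ℝ) - l| ^ (2 * H)) := by
  have hm : ∀ {i j : ℕ}, i ≤ M → j ≤ M → Integrable (fun ω ↦ B (i / M) ω * B (j / M) ω) P :=
    fun hi hj ↦ (hB.hasGaussianLaw (div_mem_Icc hi)).memLp_two.integrable_mul
      (hB.hasGaussianLaw (div_mem_Icc hj)).memLp_two
  have hexp : ∀ ω, (B ((k + 1 : ℕ) / M) ω - B (k / M) ω) * (B ((l + 1 : ℕ) / M) ω - B (l / M) ω)
      = B ((k + 1 : ℕ) / M) ω * B ((l + 1 : ℕ) / M) ω - B ((k + 1 : ℕ) / M) ω * B (l / M) ω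
        - (B (k / M) ω * B ((l + 1 : ℕ) / M) ω - B (k / M) ω * B (l / M) ω) := fun ω ↦ by ring
  simp only [hexp]
  have hs : ∀ {i j i' j' : ℕ}, i ≤ M → j ≤ M → i' ≤ M → j' ≤ M →
      Integrable (fun ω ↦ B (i / M) ω * B (j / M) ω - B (i' / M) ω * B (j' / M) ω) P :=
    fun hi hj hi' hj' ↦ (hm hi hj).sub (hm hi' hj')
  rw [integral_sub (hs (by omega) (by omega) (by omega) (by omega))
      (hs (by omega) (by omega) (by omega) (by omega)),
    integral_sub (hm (by omega) (by omega)) (hm (by omega) (by omega)),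
    integral_sub (hm (by omega) (by omega)) (hm (by omega) (by omega)),
    hB.covariance_grid (by omega) (by omega), hB.covariance_grid (by omega) (by omega),
    hB.covariance_grid (by omega) (by omega), hB.covariance_grid (by omega) (by omega)]
  push_cast
  rw [show (k : ℝ) + 1 - (l + 1) = k - l by ring]
  ring

/-- Lower bound for the variance of a Wiener sum: only the coefficients of the last increments
are needed. -/
lemma le_integral_sum_increment_sq (hB : IsFractionalBrownianMotion H 1 B P) (hH : 0 < H)
    (hH2 : H < 1 / 2) {M n j : ℕ} (hn : n ≤ M) (hj : j ≤ n) {C : ℝ} (hC : 0 ≤ C) {f : ℕ → ℝ}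
    (hf : ∀ l, j ≤ l → l < n → C ≤ f l) :
    C ^ 2 / 2 * (((n : ℝ) - j) / M) ^ (2 * H) ≤
      ∫ ω, (∑ l ∈ Finset.range n, f l * (B ((l + 1 : ℕ) / M) ω - B (l / M) ω)) ^ 2 ∂P := by
  set p := 2 * H with hp
  have hp0 : 0 < p := by positivity
  have hp1 : p ≤ 1 := by linarith
  set D : ℕ → Ω → ℝ := fun l ω ↦ B ((l + 1 : ℕ) / M) ω - B (l / M) ω with hD
  set ρ : ℕ → ℕ → ℝ := fun k l ↦ 1 / 2 / (M : ℝ) ^ p *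
    (|(k : ℝ) + 1 - l| ^ p + |(k : ℝ) - (l + 1)| ^ p - 2 * |(k : ℝ) - l| ^ p) with hρ
  have hmem : ∀ l < n, MemLp (D l) 2 P := fun l hl ↦
    (hB.hasGaussianLaw (div_mem_Icc (by omega))).memLp_two.sub
      (hB.hasGaussianLaw (div_mem_Icc (by omega))).memLp_two
  have hexp : ∫ ω, (∑ l ∈ Finset.range n, f l * D l ω) ^ 2 ∂P
      = ∑ k ∈ Finset.range n, ∑ l ∈ Finset.range n, f k * f l * ρ k l := by
    simp only [sq, Finset.sum_mul_sum]
    have hi : ∀ k ∈ Finset.range n, ∀ l ∈ Finset.range n,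
        Integrable (fun ω ↦ f k * D k ω * (f l * D l ω)) P := fun k hk l hl ↦
      ((hmem k (Finset.mem_range.1 hk)).const_mul _).integrable_mul
        ((hmem l (Finset.mem_range.1 hl)).const_mul _)
    rw [integral_finsetSum _ fun k hk ↦ integrable_finsetSum _ fun l hl ↦ hi k hk l hl]
    refine Finset.sum_congr rfl fun k hk ↦ ?_
    rw [integral_finsetSum _ fun l hl ↦ hi k hk l hl]
    refine Finset.sum_congr rfl fun l hl ↦ ?_
    have hr : ∀ ω, f k * D k ω * (f l * D l ω) = f k * f l * (D k ω * D l ω) := fun ω ↦ by ring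
    rw [Finset.mem_range] at hk hl
    simp only [hr, integral_const_mul]
    rw [hD, hB.integral_increment_mul_increment (by omega) (by omega)]
  have hsymm : ∀ k l, ρ k l = ρ l k := fun k l ↦ by
    simp only [hρ]
    rw [show (k : ℝ) + 1 - l = -(l - (k + 1)) by ring,
      show (k : ℝ) - (l + 1) = -(l + 1 - k) by ring,
      show (k : ℝ) - l = -(l - k) by ring, abs_neg, abs_neg, abs_neg]
    ring
  have hneg : ∀ k l, k ≠ l → ρ k l ≤ 0 := fun k l hkl ↦
    mul_nonpos_of_nonneg_of_nonpos (by positivity)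
      (abs_rpow_second_difference_nonpos hp0.le hp1 hkl)
  -- The row sum is the covariance of the `k`-th increment with the whole increment over `[0, n /
  -- M]`. It telescopes; the dropped end term is `(k + 1) ^ p - k ^ p ≥ 0`.
  have hrow : ∀ k < n, 1 / 2 / (M : ℝ) ^ p * (((n - k : ℕ) : ℝ) ^ p - ((n - (k + 1) : ℕ) : ℝ) ^ p)
      ≤ ∑ l ∈ Finset.range n, ρ k l := by
    intro k hk
    have ht : ∀ l, ρ k l = 1 / 2 / (M : ℝ) ^ p * ((|(k : ℝ) - (l + 1 : ℕ)| ^ p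
        - |(k : ℝ) + 1 - (l + 1 : ℕ)| ^ p) - (|(k : ℝ) - l| ^ p - |(k : ℝ) + 1 - l| ^ p)) := fun l ↦ by
      simp only [hρ]
      push_cast
      rw [show (k : ℝ) + 1 - (l + 1) = k - l by ring]
      ring
    simp only [ht]
    rw [← Finset.mul_sum,
      Finset.sum_range_sub (fun l : ℕ ↦ |(k : ℝ) - l| ^ p - |(k : ℝ) + 1 - l| ^ p)]
    have h' : (k : ℝ) + 1 ≤ n := by exact_mod_cast hk
    gcongr ?_ * ?_
    rw [Nat.cast_sub (by omega), Nat.cast_sub (by omega), abs_of_nonpos (by linarith),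
      abs_of_nonpos (by linarith), abs_of_nonneg (by simp), abs_of_nonneg (by simp; positivity)]
    have : (k : ℝ) ^ p ≤ ((k : ℝ) + 1) ^ p := by gcongr; linarith
    push_cast
    rw [show -((k : ℝ) - n) = n - k by ring, show -((k : ℝ) + 1 - n) = n - (k + 1) by ring, sub_zero,
      sub_zero]
    linarith
  have hstep : ∀ k, 0 ≤ ((n - k : ℕ) : ℝ) ^ p - ((n - (k + 1) : ℕ) : ℝ) ^ p := fun k ↦ by
    rw [sub_nonneg]
    gcongr
    omega
  rw [hexp]
  calc C ^ 2 / 2 * (((n : ℝ) - j) / M) ^ p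
      = ∑ k ∈ Finset.Ico j n, C ^ 2 * (1 / 2 / (M : ℝ) ^ p
          * (((n - k : ℕ) : ℝ) ^ p - ((n - (k + 1) : ℕ) : ℝ) ^ p)) := by
        rw [← Finset.mul_sum, ← Finset.mul_sum, Finset.sum_Ico_eq_sub _ hj,
          Finset.sum_range_sub' (fun k ↦ ((n - k : ℕ) : ℝ) ^ p),
          Finset.sum_range_sub' (fun k ↦ ((n - k : ℕ) : ℝ) ^ p), Nat.sub_self, Nat.cast_zero,
          Real.zero_rpow hp0.ne', Nat.cast_sub hj,
          Real.div_rpow (sub_nonneg.2 (by exact_mod_cast hj)) (by positivity)]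
        ring
    _ ≤ ∑ k ∈ Finset.Ico j n, f k ^ 2 * ∑ l ∈ Finset.range n, ρ k l := by
        refine Finset.sum_le_sum fun k hk ↦ ?_
        rw [Finset.mem_Ico] at hk
        have h1 := hf k hk.1 hk.2
        have h2 := hstep k
        gcongr
        exact hrow k hk.2
    _ ≤ ∑ k ∈ Finset.range n, f k ^ 2 * ∑ l ∈ Finset.range n, ρ k l := by
        refine Finset.sum_le_sum_of_subset_of_nonneg (fun k hk ↦ ?_) fun k hk _ ↦ ?_
        · rw [Finset.mem_Ico] at hk
          exact Finset.mem_range.2 hk.2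
        · exact mul_nonneg (sq_nonneg _) (le_trans (mul_nonneg (by positivity) (hstep k))
            (hrow k (Finset.mem_range.1 hk)))
    _ ≤ _ := sum_sq_mul_sum_le_sum_sum _ _ _ hsymm hneg

/-- Abel summation: the increment from `l` to `l + 1` enters every `b k` with `k > l`. -/
lemma sum_range_mul_eq_sum_tail (n : ℕ) (w b : ℕ → ℝ) (hb : b 0 = 0) :
    ∑ k ∈ Finset.range (n + 1), w k * b k
      = ∑ l ∈ Finset.range n, (∑ k ∈ Finset.Ioc l n, w k) * (b (l + 1) - b l) := by
  have h : ∀ k, b k = ∑ l ∈ Finset.range k, (b (l + 1) - b l) := fun k ↦ by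
    rw [Finset.sum_range_sub, hb, sub_zero]
  calc _ = ∑ k ∈ Finset.range (n + 1), ∑ l ∈ Finset.range k, w k * (b (l + 1) - b l) :=
        Finset.sum_congr rfl fun k _ ↦ by rw [← Finset.mul_sum, ← h]
    _ = ∑ l ∈ Finset.range n, ∑ k ∈ Finset.Ioc l n, w k * (b (l + 1) - b l) := by
        refine Finset.sum_comm' fun k l ↦ ?_
        simp only [Finset.mem_range, Finset.mem_Ioc]
        omega
    _ = _ := Finset.sum_congr rfl fun l _ ↦ by rw [Finset.sum_mul]

lemma le_integral_sum_sq (hB : IsFractionalBrownianMotion H 1 B P) (hH : 0 < H)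
    (hH2 : H < 1 / 2) {M n j : ℕ} (hn : n ≤ M) (hj : j ≤ n) {C : ℝ} (hC : 0 ≤ C) {w : ℕ → ℝ}
    (hw : ∀ l, j ≤ l → l < n → C ≤ ∑ k ∈ Finset.Ioc l n, w k) :
    C ^ 2 / 2 * (((n : ℝ) - j) / M) ^ (2 * H) ≤
      ∫ ω, (∑ k ∈ Finset.range (n + 1), w k * B (k / M) ω) ^ 2 ∂P := by
  refine (hB.le_integral_sum_increment_sq hH hH2 hn hj hC hw).trans_eq ?_
  refine integral_congr_ae ?_
  filter_upwards [hB.zero_ae_eq hH zero_le_one] with ω hω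
  rw [sum_range_mul_eq_sum_tail n w (fun k ↦ B (k / M) ω) (by simpa using hω)]

end IsFractionalBrownianMotion

/-! ### Small balls for adapted linear functions of grid values -/

namespace IsFractionalBrownianMotionVec

variable {Ω : Type*} [MeasurableSpace Ω] {P : Measure Ω} {H T : ℝ} {d : ℕ}
  {B : ℝ → Ω → EuclideanSpace ℝ (Fin d)}

lemma iIndepFun_eval {κ : Type*} (hB : IsFractionalBrownianMotionVec H T B P) (t : κ → Icc 0 T) :
    iIndepFun (fun (i : Fin d) (ω : Ω) (k : κ) ↦ B (t k) ω i) P :=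
  hB.independent.comp (fun _ x k ↦ x (t k)) fun _ ↦
    measurable_pi_lambda _ fun k ↦ measurable_pi_apply (t k)

lemma hasGaussianLaw_eval {κ : Type*} [Fintype κ] (hB : IsFractionalBrownianMotionVec H T B P)
    (t : κ → Icc 0 T) : HasGaussianLaw (fun (ω : Ω) (i : Fin d) (k : κ) ↦ B (t k) ω i) P := by
  refine (hB.iIndepFun_eval t).hasGaussianLaw fun i ↦ ?_
  have hBi := hB.component i
  have h := (hBi.isGaussianProcess.comp_right t).hasGaussianLaw Finset.univ
  exact h.map_fun (ContinuousLinearMap.pi fun k ↦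
    ContinuousLinearMap.proj (⟨k, Finset.mem_univ k⟩ : (Finset.univ : Finset κ)))

/-- Small ball estimate for linear images of the grid values `B (k / (N * m))` that are adapted and
whose coefficients on the increments of one component are bounded below. -/
theorem measure_forall_abs_sum_add_le_le (hB : IsFractionalBrownianMotionVec H 1 B P) (hH : 0 < H)
    (hH2 : H < 1 / 2) {N m : ℕ} (hN : 0 < N) (hm : 0 < m) {C r : ℝ} (hC : 0 < C) (hr : 0 ≤ r)
    (i₀ : Fin d) {W : ℕ → Fin d → ℕ → ℝ} (hW : ∀ i j k, (i + 1) * m < k → W i j k = 0)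
    (hWC : ∀ i < N, ∀ l < (i + 1) * m, C ≤ ∑ k ∈ Finset.Ioc l ((i + 1) * m), W i i₀ k)
    (u : ℕ → ℝ) :
    P {ω | ∀ i < N, |∑ j, ∑ k ∈ Finset.range (N * m + 1),
        W i j k * B ((k : ℝ) / (N * m : ℕ)) ω j + u i| ≤ r}
      ≤ gaussianReal 0 1 (Iic (r / (C / √2 * (1 / N) ^ H))) ^ N := by
  set M := N * m with hM
  have hM0 : 0 < M := Nat.mul_pos hN hm
  have hmem : ∀ k < M + 1, (k : ℝ) / M ∈ Icc (0 : ℝ) 1 := fun k hk ↦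
    IsFractionalBrownianMotion.div_mem_Icc (by omega)
  let t : Fin (M + 1) → Icc (0 : ℝ) 1 := fun k ↦ ⟨(k : ℕ) / (M : ℝ), hmem k k.2⟩
  have hG := hB.hasGaussianLaw_eval t
  have hI := hB.iIndepFun_eval t
  have := hG.isProbabilityMeasure
  have hL2 : ∀ j, ∀ k < M + 1, MemLp (fun ω ↦ B (k / M) ω j) 2 P := fun j k hk ↦
    ((hB.component j).hasGaussianLaw (hmem k hk)).memLp_two
  have hcent : ∀ (w : ℕ → ℝ) (j : Fin d),
      ∫ ω, ∑ k ∈ Finset.range (M + 1), w k * B (k / M) ω j ∂P = 0 := by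
    intro w j
    rw [integral_finsetSum _ fun k hk ↦
      ((hL2 j k (Finset.mem_range.1 hk)).integrable (by norm_num)).const_mul _]
    refine Finset.sum_eq_zero fun k hk ↦ ?_
    rw [integral_const_mul, (hB.component j).centered _ (hmem k (Finset.mem_range.1 hk)), mul_zero]
  have hL2s : ∀ (w : ℕ → ℝ) (j : Fin d),
      MemLp (fun ω ↦ ∑ k ∈ Finset.range (M + 1), w k * B (k / M) ω j) 2 P := fun w j ↦
    memLp_finsetSum _ fun k hk ↦ (hL2 j k (Finset.mem_range.1 hk)).const_mul _
  have hNr : (0 : ℝ) < N := by exact_mod_cast hN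
  have hmr : (0 : ℝ) < m := by exact_mod_cast hm
  refine measure_forall_abs_add_le_le (Y := fun i ω ↦
    ∑ j, ∑ k ∈ Finset.range (M + 1), W i j k * B (k / M) ω j) ?_ ?_ (by positivity) hr ?_ u
  · let Lc : (Fin d → Fin (M + 1) → ℝ) →L[ℝ] (Fin N → ℝ) := ContinuousLinearMap.pi fun i ↦
      ∑ j : Fin d, ∑ k : Fin (M + 1), W i j k •
        ((ContinuousLinearMap.proj k : (Fin (M + 1) → ℝ) →L[ℝ] ℝ).comp
          (ContinuousLinearMap.proj j : (Fin d → Fin (M + 1) → ℝ) →L[ℝ] (Fin (M + 1) → ℝ)))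
    have hLc : (fun ω (i : Fin N) ↦ ∑ j, ∑ k ∈ Finset.range (M + 1), W i j k * B (k / M) ω j)
        = fun ω ↦ Lc (fun j k ↦ B (t k) ω j) := by
      ext ω i
      simp [Lc, sum_apply, Finset.sum_range, t]
    rw [hLc]
    exact hG.map_fun Lc
  · intro i hi
    rw [integral_finsetSum _ fun j _ ↦ (hL2s _ j).integrable (by norm_num)]
    exact Finset.sum_eq_zero fun j _ ↦ hcent _ j
  · intro i hi c
    set w : Fin d → ℕ → ℝ := fun j k ↦ W i j k - ∑ l ∈ Finset.range i, c l * W l j k with hw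
    set U : Fin d → Ω → ℝ := fun j ω ↦ ∑ k ∈ Finset.range (M + 1), w j k * B (k / M) ω j with hU
    have hUeq : (fun ω ↦ ∑ j, ∑ k ∈ Finset.range (M + 1), W i j k * B (k / M) ω j
        - ∑ l ∈ Finset.range i, c l * ∑ j, ∑ k ∈ Finset.range (M + 1), W l j k * B (k / M) ω j)
        = ∑ j, U j := by
      ext ω
      simp only [hU, hw, Finset.sum_apply, sub_mul, Finset.sum_sub_distrib, Finset.sum_mul,
        Finset.mul_sum]
      congr 1
      rw [Finset.sum_comm]
      refine Finset.sum_congr rfl fun j _ ↦ ?_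
      rw [Finset.sum_comm]
      exact Finset.sum_congr rfl fun k _ ↦ Finset.sum_congr rfl fun l _ ↦ by ring
    have hUind : iIndepFun U P := by
      have h := hI.comp (fun j x ↦ ∑ k : Fin (M + 1), w j k * x k) fun j ↦ by fun_prop
      convert h using 2 with j
      ext ω
      simp [hU, Finset.sum_range, t]
    rw [hUeq, IndepFun.variance_sum (fun j _ ↦ hL2s (w j) j)
      fun j _ l _ hjl ↦ hUind.indepFun hjl]
    -- The other components are independent and only add variance.
    refine le_trans ?_ (Finset.single_le_sum (f := fun j ↦ Var[U j; P])
      (fun j _ ↦ variance_nonneg _ _) (Finset.mem_univ i₀))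
    rw [variance_of_integral_eq_zero (hL2s (w i₀) i₀).aemeasurable (hcent _ _)]
    have hnM : (i + 1) * m ≤ M := Nat.mul_le_mul_right m hi
    have hvan : ∀ k, (i + 1) * m < k → w i₀ k = 0 := fun k hk ↦ by
      simp only [hw, hW i i₀ k hk, zero_sub, neg_eq_zero]
      refine Finset.sum_eq_zero fun l hl ↦ ?_
      rw [hW l i₀ k (lt_of_le_of_lt (Nat.mul_le_mul_right m
        (by have := Finset.mem_range.1 hl; omega)) hk), mul_zero]
    -- Earlier variables carry no weight beyond `i * m`, so subtracting them leaves these tail sums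
    -- unchanged.
    have htail : ∀ l, i * m ≤ l → l < (i + 1) * m →
        C ≤ ∑ k ∈ Finset.Ioc l ((i + 1) * m), w i₀ k := fun l hl1 hl2 ↦ by
      refine (hWC i hi l hl2).trans_eq (Finset.sum_congr rfl fun k hk ↦ ?_)
      simp only [hw]
      rw [eq_comm, sub_eq_self]
      refine Finset.sum_eq_zero fun a ha ↦ ?_
      rw [hW a i₀ k, mul_zero]
      calc (a + 1) * m ≤ i * m := Nat.mul_le_mul_right m (Finset.mem_range.1 ha)
        _ ≤ l := hl1
        _ < k := (Finset.mem_Ioc.1 hk).1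
    have key := (hB.component i₀).le_integral_sum_sq hH hH2 hnM
      (Nat.mul_le_mul_right m (Nat.le_succ i)) hC.le htail
    have hsum : ∀ ω, ∑ k ∈ Finset.range (M + 1), w i₀ k * B (k / M) ω i₀
        = ∑ k ∈ Finset.range ((i + 1) * m + 1), w i₀ k * B (k / M) ω i₀ := fun ω ↦ by
      refine (Finset.sum_subset (Finset.range_mono (by omega)) fun k _ hk ↦ ?_).symm
      rw [Finset.mem_range] at hk
      rw [hvan k (by omega), zero_mul]
    simp only [hsum]
    refine le_trans (le_of_eq ?_) key
    rw [mul_pow, div_pow, Real.sq_sqrt (by norm_num), ← Real.rpow_natCast (_ ^ H),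
      ← Real.rpow_mul (by positivity)]
    congr 2
    · push_cast [hM]
      field_simp
      ring
    · push_cast
      ring

end IsFractionalBrownianMotionVec

/-! ### Variation of constants and its Riemann sums -/

section LinearODE

variable {E : Type*} [NormedAddCommGroup E] [NormedSpace ℝ E]

lemma continuous_exp_smul_mul [CompleteSpace E] (L : E →L[ℝ] E) :
    Continuous fun u : ℝ ↦ NormedSpace.exp (u • L) * L :=
  continuous_iff_continuousAt.2 fun u ↦
    ((hasDerivAt_exp_smul_const L u).mul_const L).continuousAt

/-- Variation of constants for `X = ξ + ∫ L X + b`, where `X` is continuous on the line. -/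
lemma integral_eq_integral_exp_of_continuous [CompleteSpace E] (L : E →L[ℝ] E) {X : ℝ → E}
    (hX : Continuous X) (t : ℝ) :
    ∫ s in (0 : ℝ)..t, L (X s) = ∫ s in (0 : ℝ)..t, (NormedSpace.exp ((t - s) • L) * L)
      (X s - ∫ r in (0 : ℝ)..s, L (X r)) := by
  set J : ℝ → E := fun s ↦ ∫ r in (0 : ℝ)..s, L (X r) with hJ
  have hLX : Continuous fun s ↦ L (X s) := L.continuous.comp hX
  have hJd : ∀ s, HasDerivAt J (L (X s)) s := fun s ↦
    intervalIntegral.integral_hasDerivAt_right (hLX.intervalIntegrable _ _)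
      (hLX.stronglyMeasurableAtFilter _ _) hLX.continuousAt
  have hJc : Continuous J := continuous_iff_continuousAt.2 fun s ↦ (hJd s).continuousAt
  have hE : ∀ s, HasDerivAt (fun s ↦ NormedSpace.exp ((t - s) • L))
      (-(NormedSpace.exp ((t - s) • L) * L)) s := fun s ↦ by
    have := (hasDerivAt_exp_smul_const L (t - s)).scomp s ((hasDerivAt_id s).const_sub t)
    simpa [Function.comp_def] using this
  -- Integrating this derivative over `[0, t]` gives the claim, since `J 0 = 0` and the exponential
  -- is the identity at `s = t`.
  have hG : ∀ s, HasDerivAt (fun s ↦ NormedSpace.exp ((t - s) • L) (J s))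
      ((NormedSpace.exp ((t - s) • L) * L) (X s - J s)) s := fun s ↦ by
    convert (hE s).clm_apply (hJd s) using 1
    simp
    abel
  have hc : Continuous fun s ↦ (NormedSpace.exp ((t - s) • L) * L) (X s - J s) :=
    ((continuous_exp_smul_mul L).comp (continuous_const.sub continuous_id)).clm_apply
      (hX.sub hJc)
  have h := intervalIntegral.integral_eq_sub_of_hasDerivAt (fun s _ ↦ hG s)
    (hc.intervalIntegrable 0 t)
  rw [h]
  simp [hJ]

/-- Left Riemann sums for a kernel applied to a path converge. -/
lemma tendsto_sum_integral_kernel {K : ℝ → E →L[ℝ] E} (hK : Continuous K) {b : ℝ → E}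
    (hb : Continuous b) {t : ℝ} (ht : 0 ≤ t) :
    Filter.Tendsto (fun n : ℕ ↦ ∑ k ∈ Finset.range n,
        ∫ s in (t * k / n)..(t * (k + 1 : ℕ) / n), K s (b (t * k / n)))
      Filter.atTop (nhds (∫ s in (0 : ℝ)..t, K s (b s))) := by
  obtain ⟨C, hC⟩ := isCompact_Icc.exists_bound_of_continuousOn (s := Icc 0 t) hK.continuousOn
  have hC0 : 0 ≤ C := (norm_nonneg _).trans (hC 0 ⟨le_rfl, ht⟩)
  have huc := isCompact_Icc.uniformContinuousOn_of_continuous (s := Icc 0 t) hb.continuousOn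
  rw [Metric.uniformContinuousOn_iff_le] at huc
  rw [Metric.tendsto_atTop]
  intro ε hε
  obtain ⟨δ, hδ, hbδ⟩ := huc (ε / (C * t + 1)) (by positivity)
  obtain ⟨n₀, hn₀⟩ := exists_nat_gt (t / δ)
  refine ⟨n₀ + 1, fun n hn ↦ ?_⟩
  have hn0 : (0 : ℝ) < n := by exact_mod_cast (by omega : 0 < n)
  have htn : t / n ≤ δ := by
    rw [div_le_iff₀ hn0]
    rw [div_lt_iff₀ hδ] at hn₀
    have : (n₀ : ℝ) ≤ n := by exact_mod_cast (by omega : n₀ ≤ n)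
    nlinarith
  have hKb : Continuous fun s ↦ K s (b s) := hK.clm_apply hb
  have hint : ∫ s in (0 : ℝ)..t, K s (b s)
      = ∑ k ∈ Finset.range n, ∫ s in (t * k / n)..(t * (k + 1 : ℕ) / n), K s (b s) := by
    rw [intervalIntegral.sum_integral_adjacent_intervals (a := fun k : ℕ ↦ t * k / n)
      fun k _ ↦ hKb.intervalIntegrable _ _]
    simp [mul_div_cancel_right₀ _ hn0.ne']
  rw [dist_eq_norm, hint, ← Finset.sum_sub_distrib]
  have hlen : ∀ k : ℕ, t * (k + 1 : ℕ) / n - t * k / n = t / n := fun k ↦ by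
    push_cast
    ring
  have hterm : ∀ k ∈ Finset.range n,
      ‖(∫ s in (t * k / n)..(t * (k + 1 : ℕ) / n), K s (b (t * k / n)))
      - ∫ s in (t * k / n)..(t * (k + 1 : ℕ) / n), K s (b s)‖
      ≤ C * (ε / (C * t + 1)) * (t / n) := by
    intro k hk
    have hkn : ((k + 1 : ℕ) : ℝ) ≤ n := by exact_mod_cast Finset.mem_range.1 hk
    have hle : t * k / n ≤ t * (k + 1 : ℕ) / n := by
      have := hlen k
      have : 0 ≤ t / n := by positivity
      linarith
    have h0 : 0 ≤ t * k / n := by positivity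
    have h1 : t * (k + 1 : ℕ) / n ≤ t := by
      rw [div_le_iff₀ hn0]
      gcongr
    rw [← intervalIntegral.integral_sub
      ((hK.clm_apply continuous_const).intervalIntegrable _ _) (hKb.intervalIntegrable _ _)]
    refine (intervalIntegral.norm_integral_le_of_norm_le_const
      (C := C * (ε / (C * t + 1))) fun s hs ↦ ?_).trans_eq ?_
    · rw [uIoc_of_le hle] at hs
      rw [← map_sub]
      refine ((K s).le_opNorm _).trans ?_
      have hs' : s ∈ Icc 0 t := ⟨by linarith [hs.1], by linarith [hs.2]⟩
      gcongr
      · exact hC s hs'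
      · rw [← dist_eq_norm]
        refine hbδ _ ⟨h0, hle.trans h1⟩ _ hs' ?_
        rw [dist_comm, Real.dist_eq, abs_of_nonneg (by linarith [hs.1])]
        linarith [hs.2, hlen k]
    · rw [hlen, abs_of_nonneg (by positivity)]
  refine ((norm_sum_le _ _).trans (Finset.sum_le_sum hterm)).trans_lt ?_
  rw [Finset.sum_const, Finset.card_range, nsmul_eq_mul]
  have : (n : ℝ) * (C * (ε / (C * t + 1)) * (t / n)) = ε * (C * t) / (C * t + 1) := by
    field_simp
  rw [this, div_lt_iff₀ (by positivity)]
  nlinarith [mul_nonneg hC0 ht]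

/-- A solution of `X = ξ + ∫ L X + b` is the limit of explicit functions of finitely many values
of `b`, up to a deterministic term. -/
lemma tendsto_discretized_solution [CompleteSpace E] (L : E →L[ℝ] E) {X b : ℝ → E} {ξ : E}
    {T : ℝ} (hX : ContinuousOn X (Icc 0 T))
    (hXb : ∀ t ∈ Icc 0 T, X t = ξ + (∫ s in (0 : ℝ)..t, L (X s)) + b t) {t : ℝ}
    (ht : t ∈ Icc 0 T) :
    Filter.Tendsto (fun n : ℕ ↦ b t + ∑ k ∈ Finset.range n,
        ∫ s in (t * k / n)..(t * (k + 1 : ℕ) / n),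
          (NormedSpace.exp ((t - s) • L) * L) (b (t * k / n)))
      Filter.atTop
      (nhds (X t - ξ - ∫ s in (0 : ℝ)..t, (NormedSpace.exp ((t - s) • L) * L) ξ)) := by
  have hT : 0 ≤ T := ht.1.trans ht.2
  -- The path is continuous only on `[0, T]`. A continuous extension allows calculus on the line,
  -- and `b'` below is a continuous version of `b` read off from the equation.
  set X' : ℝ → E := IccExtend hT ((Icc 0 T).domRestrict X) with hX'
  have hX'c : Continuous X' := (continuousOn_iff_continuous_domRestrict.1 hX).Icc_extend'
  have hXX' : ∀ s ∈ Icc 0 T, X' s = X s := fun s hs ↦ IccExtend_of_mem _ _ hs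
  set J : ℝ → E := fun s ↦ ∫ r in (0 : ℝ)..s, L (X' r) with hJ
  have hJX : ∀ s ∈ Icc 0 T, J s = ∫ r in (0 : ℝ)..s, L (X r) := fun s hs ↦ by
    refine intervalIntegral.integral_congr fun r hr ↦ ?_
    rw [uIcc_of_le hs.1] at hr
    simp only [hXX' r ⟨hr.1, hr.2.trans hs.2⟩]
  have hJc : Continuous J :=
    intervalIntegral.continuous_primitive (fun _ _ ↦
      (L.continuous.comp hX'c).intervalIntegrable _ _) 0
  set b' : ℝ → E := fun s ↦ X' s - J s - ξ with hb'
  have hb'c : Continuous b' := (hX'c.sub hJc).sub continuous_const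
  have hbb' : ∀ s ∈ Icc 0 T, b' s = b s := fun s hs ↦ by
    simp only [hb']
    rw [hXX' s hs, hJX s hs, hXb s hs]
    abel
  have hKc : Continuous fun s ↦ NormedSpace.exp ((t - s) • L) * L :=
    (continuous_exp_smul_mul L).comp (continuous_const.sub continuous_id)
  have hlim := (tendsto_sum_integral_kernel hKc hb'c ht.1).const_add (b t)
  have hid := integral_eq_integral_exp_of_continuous L hX'c t
  have hval : X t - ξ - ∫ s in (0 : ℝ)..t, (NormedSpace.exp ((t - s) • L) * L) ξ
      = b t + ∫ s in (0 : ℝ)..t, (NormedSpace.exp ((t - s) • L) * L) (b' s) := by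
    have hsplit : ∫ s in (0 : ℝ)..t, (NormedSpace.exp ((t - s) • L) * L) (b' s)
        = J t - ∫ s in (0 : ℝ)..t, (NormedSpace.exp ((t - s) • L) * L) ξ := by
      simp only [hJ]
      rw [hid, ← intervalIntegral.integral_sub]
      · simp only [hb', hJ, map_sub]
      · exact (hKc.clm_apply (hX'c.sub hJc)).intervalIntegrable _ _
      · exact (hKc.clm_apply continuous_const).intervalIntegrable _ _
    rw [hsplit, hJX t ht, hXb t ht]
    abel
  rw [hval]
  refine hlim.congr fun n ↦ ?_
  congr 1
  refine Finset.sum_congr rfl fun k hk ↦ ?_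
  have hmem : t * k / n ∈ Icc 0 T := by
    have hkn : (k : ℝ) ≤ n := by exact_mod_cast (Finset.mem_range.1 hk).le
    refine ⟨by have := ht.1; positivity, le_trans ?_ ht.2⟩
    refine div_le_of_le_mul₀ (by positivity) ht.1 ?_
    exact mul_le_mul_of_nonneg_left hkn ht.1
  rw [hbb' _ hmem]

end LinearODE

lemma toEuclideanCLM_exp_mul {d : ℕ} (A : Matrix (Fin d) (Fin d) ℝ) (u : ℝ) :
    NormedSpace.exp (u • Matrix.toEuclideanCLM (𝕜 := ℝ) A) * Matrix.toEuclideanCLM (𝕜 := ℝ) A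
      = Matrix.toEuclideanCLM (𝕜 := ℝ) (NormedSpace.exp (u • A) * A) := by
  let _ : NormedRing (Matrix (Fin d) (Fin d) ℝ) := Matrix.linftyOpNormedRing
  let _ : NormedAlgebra ℝ (Matrix (Fin d) (Fin d) ℝ) := Matrix.linftyOpNormedAlgebra
  let _ : NormedAlgebra ℚ (Matrix (Fin d) (Fin d) ℝ) := NormedAlgebra.restrictScalars ℚ ℝ _
  have hc : Continuous (Matrix.toEuclideanCLM (𝕜 := ℝ) (n := Fin d)) :=
    (Matrix.toEuclideanCLM (𝕜 := ℝ) (n := Fin d)).toAlgEquiv.toLinearMap.continuous_of_finiteDimensional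
  rw [map_mul, ← map_smul]
  congr 1
  exact (NormedSpace.map_exp (Matrix.toEuclideanCLM (𝕜 := ℝ) (n := Fin d)) hc (u • A)).symm

lemma continuous_exp_smul_mul_apply {d : ℕ} (A : Matrix (Fin d) (Fin d) ℝ) (i j : Fin d) :
    Continuous fun u : ℝ ↦ (NormedSpace.exp (u • A) * A) i j := by
  let _ : NormedRing (Matrix (Fin d) (Fin d) ℝ) := Matrix.linftyOpNormedRing
  let _ : NormedAlgebra ℝ (Matrix (Fin d) (Fin d) ℝ) := Matrix.linftyOpNormedAlgebra
  have h : Continuous fun u : ℝ ↦ NormedSpace.exp (u • A) * A :=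
    continuous_iff_continuousAt.2 fun u ↦
      ((hasDerivAt_exp_smul_const A u).mul_const A).continuousAt
  exact h.matrix_elem i j

/-! ### Gaussian tails and passage to the limit -/

/-- With `x = 1 / (2 * √H)` one has `N ≥ exp (4 * x ^ 2)`, which beats a tail `p` of order at least
`exp (-x ^ 2)`. Thus `N * p ≥ 1/2`, and `(1 - p) ^ N ≤ exp (-N * p)`. -/
lemma gaussianReal_Iic_pow_ceil_le {H : ℝ} (hH : 0 < H) (hH2 : H < 1 / 2) :
    gaussianReal 0 1 (Iic (1 / (2 * √H))) ^ ⌈Real.exp (1 / H)⌉₊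
      ≤ ENNReal.ofReal (Real.exp (-(1 / 2))) := by
  set N := ⌈Real.exp (1 / H)⌉₊ with hN
  set x := 1 / (2 * √H) with hx
  have hsq : x ^ 2 = 1 / H / 4 := by
    rw [hx, div_pow, mul_pow, Real.sq_sqrt hH.le]
    field_simp
    norm_num
  have hx0 : 0 < x := by positivity
  have hx2 : 1 / 2 ≤ x ^ 2 := by
    rw [hsq, div_div, div_le_div_iff₀ (by norm_num) (by positivity)]
    linarith
  set p := (gaussianReal 0 1).real (Ioi x) with hp
  have hφ : 1 / √(2 * Real.pi) * Real.exp (-1 - x ^ 2) ≤ p := by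
    rw [hp, measureReal_def, gaussianReal_apply_eq_integral _ one_ne_zero,
      ENNReal.toReal_ofReal (setIntegral_nonneg measurableSet_Ioi
        fun y _ ↦ gaussianPDFReal_nonneg _ _ _)]
    -- On `(x, x + 1]` one has `y ^ 2 / 2 ≤ (x + 1) ^ 2 / 2 ≤ 1 + x ^ 2`.
    calc 1 / √(2 * Real.pi) * Real.exp (-1 - x ^ 2)
        = ∫ _ in Ioc x (x + 1), 1 / √(2 * Real.pi) * Real.exp (-1 - x ^ 2) := by
          simp
      _ ≤ ∫ y in Ioc x (x + 1), gaussianPDFReal 0 1 y := by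
          refine setIntegral_mono_on (integrable_const _) (integrable_gaussianPDFReal 0 1).integrableOn
            measurableSet_Ioc fun y hy ↦ ?_
          simp only [gaussianPDFReal, NNReal.coe_one, mul_one, sub_zero]
          rw [one_div]
          gcongr
          nlinarith [hy.1, hy.2, sq_nonneg (x - 1)]
      _ ≤ ∫ y in Ioi x, gaussianPDFReal 0 1 y :=
          setIntegral_mono_set (integrable_gaussianPDFReal 0 1).integrableOn
            (.of_forall fun y ↦ gaussianPDFReal_nonneg _ _ _) (Ioc_subset_Ioi_self).eventuallyLE
  have hNp : 1 / 2 ≤ N * p := by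
    have h1 : Real.exp (4 * x ^ 2) ≤ N := by
      rw [hsq, mul_div_cancel₀ _ (by norm_num : (4 : ℝ) ≠ 0)]
      exact Nat.le_ceil _
    have h2 : √(2 * Real.pi) ≤ 3 := by
      rw [Real.sqrt_le_left (by norm_num)]
      linarith [Real.pi_lt_four]
    have h3 : 0 < √(2 * Real.pi) := by positivity
    have h4 : (3 : ℝ) / 2 ≤ Real.exp (3 * x ^ 2 - 1) := by
      have := Real.add_one_le_exp (3 * x ^ 2 - 1)
      linarith
    calc (1 : ℝ) / 2 = 1 / 3 * (3 / 2) := by norm_num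
      _ ≤ 1 / √(2 * Real.pi) * Real.exp (3 * x ^ 2 - 1) := by gcongr
      _ = Real.exp (4 * x ^ 2) * (1 / √(2 * Real.pi) * Real.exp (-1 - x ^ 2)) := by
          rw [mul_left_comm, ← Real.exp_add]
          ring_nf
      _ ≤ N * p := by gcongr
  have hcompl : gaussianReal 0 1 (Iic x) = ENNReal.ofReal (1 - p) := by
    rw [← compl_Ioi, ← ofReal_measureReal, probReal_compl_eq_one_sub measurableSet_Ioi]
  have hp1 : p ≤ 1 := measureReal_le_one
  rw [hcompl, ← ENNReal.ofReal_pow (by linarith)]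
  refine ENNReal.ofReal_le_ofReal ?_
  calc (1 - p) ^ N ≤ Real.exp (-p) ^ N := by
        gcongr
        linarith [Real.add_one_le_exp (-p)]
    _ = Real.exp (-(N * p)) := by rw [← Real.exp_nat_mul]; ring_nf
    _ ≤ _ := by gcongr

lemma measure_le_of_ae_eventually_mem {Ω : Type*} [MeasurableSpace Ω] {P : Measure Ω}
    {S : Set Ω} {Sn : ℕ → Set Ω} {q : ENNReal}
    (h : ∀ᵐ ω ∂P, ω ∈ S → ∀ᶠ n in Filter.atTop, ω ∈ Sn n) (hq : ∀ n, P (Sn n) ≤ q) :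
    P S ≤ q := by
  calc P S ≤ P (⋃ n, ⋂ k ∈ Ici n, Sn k) := by
        refine measure_mono_ae ?_
        filter_upwards [h] with ω hω hS
        obtain ⟨n, hn⟩ := Filter.eventually_atTop.1 (hω hS)
        exact mem_iUnion.2 ⟨n, mem_iInter₂.2 fun k hk ↦ hn k hk⟩
    _ = ⨆ n, P (⋂ k ∈ Ici n, Sn k) := by
        refine Monotone.measure_iUnion fun a b hab ↦ ?_
        exact biInter_subset_biInter_left (Ici_subset_Ici.2 hab)
    _ ≤ q := iSup_le fun n ↦ (measure_mono (biInter_subset_of_mem self_mem_Ici)).trans (hq n)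

/-- Fatou's lemma. -/
lemma integrable_of_tendsto_ae_of_integral_norm_le {Ω E : Type*} [MeasurableSpace Ω]
    [NormedAddCommGroup E] {P : Measure Ω} {g : ℕ → Ω → E} {f : Ω → E} {D : ℝ}
    (hg : ∀ n, Integrable (g n) P) (hD : ∀ n, ∫ ω, ‖g n ω‖ ∂P ≤ D)
    (h : ∀ᵐ ω ∂P, Filter.Tendsto (fun n ↦ g n ω) Filter.atTop (nhds (f ω))) :
    Integrable f P := by
  refine ⟨aestronglyMeasurable_of_tendsto_ae Filter.atTop (fun n ↦ (hg n).aestronglyMeasurable) h,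
    ?_⟩
  have hle : ∫⁻ ω, ‖f ω‖ₑ ∂P ≤ ENNReal.ofReal D := by
    calc ∫⁻ ω, ‖f ω‖ₑ ∂P = ∫⁻ ω, Filter.liminf (fun n ↦ ‖g n ω‖ₑ) Filter.atTop ∂P := by
          refine lintegral_congr_ae ?_
          filter_upwards [h] with ω hω
          exact (hω.enorm.liminf_eq).symm
      _ ≤ Filter.liminf (fun n ↦ ∫⁻ ω, ‖g n ω‖ₑ ∂P) Filter.atTop :=
          lintegral_liminf_le' fun n ↦ (hg n).aestronglyMeasurable.enorm
      _ ≤ ENNReal.ofReal D := by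
          refine Filter.liminf_le_of_frequently_le' (.of_forall fun n ↦ ?_)
          rw [← ofReal_integral_norm_eq_lintegral_enorm (hg n)]
          exact ENNReal.ofReal_le_ofReal (hD n)
  exact hle.trans_lt ENNReal.ofReal_lt_top

namespace IsFractionalBrownianMotionVec

variable {Ω : Type*} [MeasurableSpace Ω] {P : Measure Ω} {H : ℝ} {d : ℕ}
  {B : ℝ → Ω → EuclideanSpace ℝ (Fin d)}

lemma integrable [IsProbabilityMeasure P] (hB : IsFractionalBrownianMotionVec H 1 B P) {t : ℝ}
    (ht : t ∈ Icc (0 : ℝ) 1) : Integrable (B t) P := by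
  have h : Integrable (fun ω ↦ WithLp.toLp 2 fun j ↦ B t ω j) P :=
    (PiLp.continuousLinearEquiv 2 ℝ fun _ : Fin d ↦ ℝ).symm.toContinuousLinearMap.integrable_comp
      (Integrable.of_eval fun j ↦ ((hB.component j).hasGaussianLaw ht).integrable)
  exact h

lemma integral_norm_le [IsProbabilityMeasure P] (hB : IsFractionalBrownianMotionVec H 1 B P)
    (hH : 0 < H) {t : ℝ} (ht : t ∈ Icc (0 : ℝ) 1) : ∫ ω, ‖B t ω‖ ∂P ≤ d * 2 := by
  have hL2 : ∀ j, MemLp (fun ω ↦ B t ω j) 2 P := fun j ↦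
    ((hB.component j).hasGaussianLaw ht).memLp_two
  have hi : ∀ j, Integrable (fun ω ↦ 1 + B t ω j ^ 2) P := fun j ↦
    (integrable_const _).add (hL2 j).integrable_sq
  have hle : ∀ ω, ‖B t ω‖ ≤ ∑ j, (1 + B t ω j ^ 2) := fun ω ↦ by
    have h1 : ‖B t ω‖ ^ 2 ≤ (∑ j, |B t ω j|) ^ 2 := by
      rw [EuclideanSpace.norm_sq_eq]
      simp only [Real.norm_eq_abs]
      exact Finset.sum_sq_le_sq_sum_of_nonneg fun j _ ↦ abs_nonneg _
    have h2 := le_of_sq_le_sq h1 (Finset.sum_nonneg fun j _ ↦ abs_nonneg _)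
    refine h2.trans (Finset.sum_le_sum fun j _ ↦ ?_)
    nlinarith [sq_abs (B t ω j), sq_nonneg (|B t ω j| - 1 / 2)]
  calc ∫ ω, ‖B t ω‖ ∂P ≤ ∫ ω, ∑ j, (1 + B t ω j ^ 2) ∂P :=
        integral_mono (hB.integrable ht).norm (integrable_finsetSum _ fun j _ ↦ hi j) hle
    _ = ∑ _j : Fin d, (1 + t ^ (2 * H)) := by
        rw [integral_finsetSum _ fun j _ ↦ hi j]
        refine Finset.sum_congr rfl fun j _ ↦ ?_
        rw [integral_add (integrable_const _) (hL2 j).integrable_sq,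
          (hB.component j).integral_sq hH ht]
        simp
    _ ≤ ∑ _j : Fin d, (2 : ℝ) := by
        refine Finset.sum_le_sum fun j _ ↦ ?_
        linarith [Real.rpow_le_one ht.1 ht.2 (by positivity : 0 ≤ 2 * H)]
    _ = d * 2 := by simp

end IsFractionalBrownianMotionVec

/-! ### Weights of the discretized solution -/

/-- Coefficient of the `j`-th coordinate of the value at `k / M` in the `i₀`-th coordinate of the
discretized solution at time `n / M`. -/
noncomputable def discretizationWeight {d : ℕ} (A : Matrix (Fin d) (Fin d) ℝ) (i₀ : Fin d)
    (M n : ℕ) (j : Fin d) (k : ℕ) : ℝ :=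
  (if j = i₀ ∧ k = n then 1 else 0) + if k < n then
    ∫ s in ((k : ℝ) / M)..((k + 1 : ℕ) / M), (NormedSpace.exp (((n : ℝ) / M - s) • A) * A) i₀ j
  else 0

section discretizationWeight

variable {d : ℕ} (A : Matrix (Fin d) (Fin d) ℝ) (i₀ : Fin d) {M n : ℕ}

lemma discretizationWeight_of_lt {k : ℕ} (h : n < k) (j : Fin d) :
    discretizationWeight A i₀ M n j k = 0 := by
  simp [discretizationWeight, h.ne', h.not_gt]

/-- The value at the final time contributes `1`. Each of the fewer than `M` other terms is at least
`(-1 + C) / M`, which is negative, so together they cost at most `1 - C`. -/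
lemma le_sum_discretizationWeight {C : ℝ} (hC1 : C < 1)
    (hA : ∀ t ∈ Icc (0 : ℝ) 1, -1 + C ≤ (NormedSpace.exp (t • A) * A) i₀ i₀)
    (hM : 0 < M) (hn : n ≤ M) {l : ℕ} (hl : l < n) :
    C ≤ ∑ k ∈ Finset.Ioc l n, discretizationWeight A i₀ M n i₀ k := by
  have hMr : (0 : ℝ) < M := by exact_mod_cast hM
  have hnM : (n : ℝ) ≤ M := by exact_mod_cast hn
  have hc : Continuous fun s : ℝ ↦ (NormedSpace.exp (((n : ℝ) / M - s) • A) * A) i₀ i₀ :=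
    (continuous_exp_smul_mul_apply A i₀ i₀).comp (continuous_const.sub continuous_id)
  have hterm : ∀ k < n, (-1 + C) / M ≤ ∫ s in ((k : ℝ) / M)..((k + 1 : ℕ) / M),
      (NormedSpace.exp (((n : ℝ) / M - s) • A) * A) i₀ i₀ := by
    intro k hk
    have hkn : ((k + 1 : ℕ) : ℝ) ≤ n := by exact_mod_cast hk
    have hle : (k : ℝ) / M ≤ (k + 1 : ℕ) / M := by gcongr; omega
    have h : ∫ _ in ((k : ℝ) / M)..((k + 1 : ℕ) / M), (-1 + C)
        ≤ ∫ s in ((k : ℝ) / M)..((k + 1 : ℕ) / M),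
          (NormedSpace.exp (((n : ℝ) / M - s) • A) * A) i₀ i₀ := by
      refine intervalIntegral.integral_mono_on hle (by simp) (hc.intervalIntegrable _ _)
        fun s hs ↦ hA _ ⟨?_, ?_⟩
      · have : ((k + 1 : ℕ) : ℝ) / M ≤ n / M := by gcongr
        linarith [hs.2]
      · have h1 : (n : ℝ) / M ≤ 1 := div_le_one_of_le₀ hnM hMr.le
        have h2 : 0 ≤ (k : ℝ) / M := by positivity
        linarith [hs.1]
    refine le_trans (le_of_eq ?_) h
    rw [intervalIntegral.integral_const, smul_eq_mul]
    push_cast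
    ring
  have hlast : discretizationWeight A i₀ M n i₀ n = 1 := by simp [discretizationWeight]
  have hmid : ∀ k ∈ Finset.Ioo l n, (-1 + C) / M ≤ discretizationWeight A i₀ M n i₀ k :=
    fun k hk ↦ by
      have hkn := (Finset.mem_Ioo.1 hk).2
      simpa [discretizationWeight, hkn, hkn.ne] using hterm k hkn
  have hcard : ((n - l - 1 : ℕ) : ℝ) ≤ M := by exact_mod_cast (by omega : n - l - 1 ≤ M)
  rw [← Finset.sum_Ioo_add_eq_sum_Ioc hl, hlast]
  have h := Finset.card_nsmul_le_sum _ _ _ hmid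
  rw [Nat.card_Ioo, nsmul_eq_mul] at h
  have h' : -1 + C ≤ ((n - l - 1 : ℕ) : ℝ) * ((-1 + C) / M) := by
    rw [mul_div_assoc', le_div_iff₀ hMr]
    nlinarith
  linarith

lemma discretized_solution_apply (b : ℝ → EuclideanSpace ℝ (Fin d)) (hM : 0 < M) (hn0 : 0 < n)
    (hn : n ≤ M) {t : ℝ} (ht : t = n / M) :
    (b t + ∑ k ∈ Finset.range n, ∫ s in (t * k / n)..(t * (k + 1 : ℕ) / n),
        (NormedSpace.exp ((t - s) • Matrix.toEuclideanCLM (𝕜 := ℝ) A)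
          * Matrix.toEuclideanCLM (𝕜 := ℝ) A) (b (t * k / n))) i₀
      = ∑ j, ∑ k ∈ Finset.range (M + 1), discretizationWeight A i₀ M n j k * b (k / M) j := by
  have hMr : (0 : ℝ) < M := by exact_mod_cast hM
  have hnr : (0 : ℝ) < n := by exact_mod_cast hn0
  have hpt : ∀ k : ℝ, t * k / n = k / M := fun k ↦ by
    rw [ht]
    field_simp
  have hcK : Continuous fun s ↦ NormedSpace.exp ((t - s) • Matrix.toEuclideanCLM (𝕜 := ℝ) A)
      * Matrix.toEuclideanCLM (𝕜 := ℝ) A :=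
    (continuous_exp_smul_mul _).comp (continuous_const.sub continuous_id)
  have hcoord : ∀ k : ℕ, (∫ s in (t * k / n)..(t * (k + 1 : ℕ) / n),
        (NormedSpace.exp ((t - s) • Matrix.toEuclideanCLM (𝕜 := ℝ) A)
          * Matrix.toEuclideanCLM (𝕜 := ℝ) A) (b (t * k / n))) i₀
      = ∑ j, (∫ s in ((k : ℝ) / M)..((k + 1 : ℕ) / M),
          (NormedSpace.exp (((n : ℝ) / M - s) • A) * A) i₀ j) * b (k / M) j := by
    intro k
    have h : ∫ s in (t * k / n)..(t * (k + 1 : ℕ) / n),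
          ((NormedSpace.exp ((t - s) • Matrix.toEuclideanCLM (𝕜 := ℝ) A)
            * Matrix.toEuclideanCLM (𝕜 := ℝ) A) (b (t * k / n))) i₀
        = (∫ s in (t * k / n)..(t * (k + 1 : ℕ) / n),
          (NormedSpace.exp ((t - s) • Matrix.toEuclideanCLM (𝕜 := ℝ) A)
            * Matrix.toEuclideanCLM (𝕜 := ℝ) A) (b (t * k / n))) i₀ :=
      (EuclideanSpace.proj i₀ : EuclideanSpace ℝ (Fin d) →L[ℝ] ℝ).intervalIntegral_comp_comm
        ((hcK.clm_apply (continuous_const (y := b (t * k / n)))).intervalIntegrable _ _)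
    rw [← h, hpt, hpt]
    simp only [toEuclideanCLM_exp_mul, ht, ← intervalIntegral.integral_mul_const]
    rw [← intervalIntegral.integral_finsetSum]
    · refine intervalIntegral.integral_congr fun s _ ↦ ?_
      simp only [Matrix.ofLp_toEuclideanCLM]
      rfl
    · intro j _
      exact (((continuous_exp_smul_mul_apply A i₀ j).comp
        (continuous_const.sub continuous_id)).mul continuous_const).intervalIntegrable _ _
  have hl : (b t + ∑ k ∈ Finset.range n, ∫ s in (t * k / n)..(t * (k + 1 : ℕ) / n),
        (NormedSpace.exp ((t - s) • Matrix.toEuclideanCLM (𝕜 := ℝ) A)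
          * Matrix.toEuclideanCLM (𝕜 := ℝ) A) (b (t * k / n))) i₀
      = b t i₀ + ∑ k ∈ Finset.range n, ∑ j, (∫ s in ((k : ℝ) / M)..((k + 1 : ℕ) / M),
          (NormedSpace.exp (((n : ℝ) / M - s) • A) * A) i₀ j) * b (k / M) j := by
    rw [PiLp.add_apply, WithLp.ofLp_sum, Finset.sum_apply]
    simp only [hcoord]
  rw [hl]
  simp only [discretizationWeight, add_mul, Finset.sum_add_distrib]
  congr 1
  · rw [Finset.sum_eq_single i₀ (fun j _ hj ↦ by simp [hj]) (by simp),
      Finset.sum_eq_single n (fun k _ hk ↦ by simp [hk])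
        (fun h ↦ absurd (Finset.mem_range.2 (by omega)) h)]
    simp [ht]
  · rw [Finset.sum_comm]
    refine Finset.sum_congr rfl fun j _ ↦ ?_
    rw [← Finset.sum_subset (Finset.range_mono (by omega : n ≤ M + 1)) fun k _ hk ↦ by
      rw [if_neg (by simpa using hk), zero_mul]]
    exact Finset.sum_congr rfl fun k hk ↦ by rw [if_pos (Finset.mem_range.1 hk)]

end discretizationWeight

/-! ### Integrability and small balls for the Ornstein-Uhlenbeck process -/

namespace IsFractionalOU

variable {Ω : Type*} [MeasurableSpace Ω] {P : Measure Ω} {H : ℝ} {d : ℕ}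
  {A : Matrix (Fin d) (Fin d) ℝ} {ξ : EuclideanSpace ℝ (Fin d)}
  {B X : ℝ → Ω → EuclideanSpace ℝ (Fin d)}

theorem integrable [IsProbabilityMeasure P] (hX : IsFractionalOU 1 A ξ B X P)
    (hB : IsFractionalBrownianMotionVec H 1 B P) (hH : 0 < H) {t : ℝ} (ht : t ∈ Icc (0 : ℝ) 1) :
    Integrable (X t) P := by
  set L := Matrix.toEuclideanCLM (𝕜 := ℝ) A with hL
  set v : EuclideanSpace ℝ (Fin d) := ∫ s in (0 : ℝ)..t, (NormedSpace.exp ((t - s) • L) * L) ξ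
  have hcK : Continuous fun s ↦ NormedSpace.exp ((t - s) • L) * L :=
    (continuous_exp_smul_mul _).comp (continuous_const.sub continuous_id)
  obtain ⟨C, hC⟩ := isCompact_Icc.exists_bound_of_continuousOn (s := Icc 0 t) hcK.continuousOn
  have hC0 : 0 ≤ C := (norm_nonneg _).trans (hC 0 ⟨le_rfl, ht.1⟩)
  -- Integrating the kernel first makes each Riemann term a fixed operator, of norm at most `C * t /
  -- n`, applied to one value of `B`; this bounds the first moments uniformly in `n`.
  let Φ : ℕ → ℕ → EuclideanSpace ℝ (Fin d) →L[ℝ] EuclideanSpace ℝ (Fin d) := fun n k ↦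
    ∫ s in (t * k / n)..(t * (k + 1 : ℕ) / n), NormedSpace.exp ((t - s) • L) * L
  let g : ℕ → Ω → EuclideanSpace ℝ (Fin d) := fun n ω ↦
    B t ω + ∑ k ∈ Finset.range n, Φ n k (B (t * k / n) ω)
  have hmem : ∀ n, ∀ k ∈ Finset.range n, t * k / n ∈ Icc (0 : ℝ) 1 := fun n k hk ↦ by
    have hkn : (k : ℝ) ≤ n := by exact_mod_cast (Finset.mem_range.1 hk).le
    refine ⟨by have := ht.1; positivity, le_trans ?_ ht.2⟩
    refine div_le_of_le_mul₀ (by positivity) ht.1 ?_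
    exact mul_le_mul_of_nonneg_left hkn ht.1
  have hΦ : ∀ n, ∀ k ∈ Finset.range n, ‖Φ n k‖ ≤ C * (t / n) := fun n k hk ↦ by
    have hn0 : (0 : ℝ) < n := by
      exact_mod_cast (Nat.zero_le k).trans_lt (Finset.mem_range.1 hk)
    have hkn : ((k + 1 : ℕ) : ℝ) ≤ n := by exact_mod_cast Finset.mem_range.1 hk
    have h0 : 0 ≤ t / n := div_nonneg ht.1 hn0.le
    have hlen : t * (k + 1 : ℕ) / n - t * k / n = t / n := by
      push_cast
      ring
    have h1 : t * (k + 1 : ℕ) / n ≤ t := by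
      rw [div_le_iff₀ hn0]
      exact mul_le_mul_of_nonneg_left hkn ht.1
    refine (intervalIntegral.norm_integral_le_of_norm_le_const fun s hs ↦ hC s ?_).trans_eq ?_
    · rw [uIoc_of_le (by linarith)] at hs
      exact ⟨(hmem n k hk).1.trans hs.1.le, hs.2.trans h1⟩
    · rw [hlen, abs_of_nonneg h0]
  have hgi : ∀ n, Integrable (g n) P := fun n ↦
    (hB.integrable ht).add (integrable_finsetSum _ fun k hk ↦
      (Φ n k).integrable_comp (hB.integrable (hmem n k hk)))
  have hgD : ∀ n, ∫ ω, ‖g n ω‖ ∂P ≤ d * 2 + C * t * (d * 2) := by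
    intro n
    have hle : ∀ ω, ‖g n ω‖ ≤ ‖B t ω‖ + ∑ k ∈ Finset.range n, C * (t / n) * ‖B (t * k / n) ω‖ :=
      fun ω ↦ (norm_add_le _ _).trans (add_le_add le_rfl ((norm_sum_le _ _).trans
        (Finset.sum_le_sum fun k hk ↦ ((Φ n k).le_opNorm _).trans
          (mul_le_mul_of_nonneg_right (hΦ n k hk) (norm_nonneg _)))))
    have hsi : Integrable (fun ω ↦ ∑ k ∈ Finset.range n, C * (t / n) * ‖B (t * k / n) ω‖) P :=
      integrable_finsetSum _ fun k hk ↦ (hB.integrable (hmem n k hk)).norm.const_mul _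
    calc ∫ ω, ‖g n ω‖ ∂P
        ≤ ∫ ω, (‖B t ω‖ + ∑ k ∈ Finset.range n, C * (t / n) * ‖B (t * k / n) ω‖) ∂P :=
          integral_mono (hgi n).norm ((hB.integrable ht).norm.add hsi) hle
      _ = ∫ ω, ‖B t ω‖ ∂P
          + ∑ k ∈ Finset.range n, C * (t / n) * ∫ ω, ‖B (t * k / n) ω‖ ∂P := by
          rw [integral_add (hB.integrable ht).norm hsi, integral_finsetSum _ fun k hk ↦
            (hB.integrable (hmem n k hk)).norm.const_mul _]
          simp only [integral_const_mul]
      _ ≤ d * 2 + ∑ k ∈ Finset.range n, C * (t / n) * (d * 2) := by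
          refine add_le_add (hB.integral_norm_le hH ht) (Finset.sum_le_sum fun k hk ↦ ?_)
          exact mul_le_mul_of_nonneg_left (hB.integral_norm_le hH (hmem n k hk))
            (mul_nonneg hC0 (div_nonneg ht.1 (Nat.cast_nonneg n)))
      _ ≤ d * 2 + C * t * (d * 2) := by
          rw [Finset.sum_const, Finset.card_range, nsmul_eq_mul]
          rcases Nat.eq_zero_or_pos n with rfl | hn
          · have := mul_nonneg hC0 ht.1
            simp only [Nat.cast_zero, zero_mul]
            gcongr
            positivity
          · have hn0 : (n : ℝ) ≠ 0 := by exact_mod_cast hn.ne'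
            exact le_of_eq (by field_simp)
  have hlim : ∀ᵐ ω ∂P, Filter.Tendsto (fun n ↦ g n ω) Filter.atTop (nhds (X t ω - ξ - v)) := by
    filter_upwards [hX] with ω hω
    refine (tendsto_discretized_solution L hω.1 hω.2 ht).congr fun n ↦ ?_
    simp only [g, Φ]
    congr 1
    refine Finset.sum_congr rfl fun k _ ↦ ?_
    exact (ContinuousLinearMap.intervalIntegral_apply (hcK.intervalIntegrable _ _) _).symm
  have h := integrable_of_tendsto_ae_of_integral_norm_le hgi hgD hlim
  have h2 := h.add (integrable_const (ξ + v))
  refine h2.congr (.of_forall fun ω ↦ ?_)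
  simp only [Pi.add_apply]
  abel

/-- Small ball estimate for one coordinate of the solution at the times `1 / N, …, N / N`. -/
theorem measure_forall_abs_sub_lt_le (hX : IsFractionalOU 1 A ξ B X P)
    (hB : IsFractionalBrownianMotionVec H 1 B P) (hH : 0 < H) (hH2 : H < 1 / 2) {i₀ : Fin d}
    {C r : ℝ} (hC : 0 < C) (hC1 : C < 1)
    (hA : ∀ t ∈ Icc (0 : ℝ) 1, -1 + C ≤ (NormedSpace.exp (t • A) * A) i₀ i₀) {N : ℕ} (hN : 0 < N)
    (hr : 0 ≤ r) (μ : ℕ → ℝ) :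
    P {ω | ∀ i < N, |X ((i + 1 : ℕ) / N) ω i₀ - μ i| < r}
      ≤ gaussianReal 0 1 (Iic (r / (C / √2 * (1 / N) ^ H))) ^ N := by
  set L := Matrix.toEuclideanCLM (𝕜 := ℝ) A with hL
  have hNr : (0 : ℝ) < N := by exact_mod_cast hN
  let τ : ℕ → ℝ := fun i ↦ (i + 1 : ℕ) / N
  have hτ : ∀ i < N, τ i ∈ Icc (0 : ℝ) 1 := fun i hi ↦
    IsFractionalBrownianMotion.div_mem_Icc hi
  let v : ℕ → EuclideanSpace ℝ (Fin d) := fun i ↦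
    ξ + ∫ s in (0 : ℝ)..τ i, (NormedSpace.exp ((τ i - s) • L) * L) ξ
  let W : ℕ → ℕ → Fin d → ℕ → ℝ := fun m i ↦
    discretizationWeight A i₀ (N * (m + 1)) ((i + 1) * (m + 1))
  -- The strict inequality in the limit event passes to all sufficiently fine grids, where the
  -- non-strict one is estimated. Using `m + 1` keeps the refinement factor positive.
  refine measure_le_of_ae_eventually_mem (Sn := fun m ↦ {ω | ∀ i < N,
    |∑ j, ∑ k ∈ Finset.range (N * (m + 1) + 1), W m i j k * B ((k : ℝ) / (N * (m + 1) : ℕ)) ω j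
      + (v i i₀ - μ i)| ≤ r}) ?_ fun m ↦ ?_
  · filter_upwards [hX] with ω hω hS
    refine (Filter.eventually_all_finite (finite_lt_nat N)).2 fun i hi ↦ ?_
    have hlim := tendsto_discretized_solution L hω.1 hω.2 (hτ i hi)
    have hsub : Filter.Tendsto (fun m : ℕ ↦ (i + 1) * (m + 1)) Filter.atTop Filter.atTop :=
      Filter.tendsto_atTop_mono (fun m ↦ by simp only [id]; nlinarith) Filter.tendsto_id
    have hlim2 := ((EuclideanSpace.proj i₀ : EuclideanSpace ℝ (Fin d) →L[ℝ] ℝ).continuous.tendsto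
      _).comp (hlim.comp hsub)
    have hlim3 : Filter.Tendsto (fun m : ℕ ↦ |∑ j, ∑ k ∈ Finset.range (N * (m + 1) + 1),
        W m i j k * B ((k : ℝ) / (N * (m + 1) : ℕ)) ω j + (v i i₀ - μ i)|) Filter.atTop
        (nhds |X (τ i) ω i₀ - μ i|) := by
      have hval : X (τ i) ω i₀ - μ i = (X (τ i) ω - ξ - ∫ s in (0 : ℝ)..τ i,
          (NormedSpace.exp ((τ i - s) • L) * L) ξ) i₀ + (v i i₀ - μ i) := by
        simp only [v, PiLp.sub_apply, PiLp.add_apply]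
        ring
      rw [hval]
      refine ((hlim2.congr fun m ↦ ?_).add_const _).abs
      have hd := discretized_solution_apply A i₀ (fun s ↦ B s ω) (M := N * (m + 1))
        (n := (i + 1) * (m + 1)) (t := τ i) (by positivity) (by positivity)
        (Nat.mul_le_mul_right _ hi) (by
          simp only [τ]
          push_cast
          field_simp)
      exact hd
    exact (hlim3.eventually_lt_const (hS i hi)).mono fun m hm ↦ hm.le
  · refine hB.measure_forall_abs_sum_add_le_le hH hH2 hN (Nat.succ_pos m) hC hr i₀
      (fun i j k hk ↦ discretizationWeight_of_lt A i₀ hk j) (fun i hi l hl ↦ ?_) _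
    exact le_sum_discretizationWeight A i₀ hC1 hA (by positivity)
      (Nat.mul_le_mul_right _ hi) hl

end IsFractionalOU

/-! ### Choice of constants and conclusion -/

lemma exp_mul_sqrt_log_le {C H : ℝ} (hC : 0 < C) (hH : 0 < H) :
    Real.exp (-(1 / 2)) * √((1 / H) * Real.log (2 * C / Real.exp (-(1 / 2)))) ≤ 2 * C / √H := by
  set e := Real.exp (-(1 / 2)) with he
  have he0 : 0 < e := Real.exp_pos _
  have hz : 0 < 2 * C / e := by positivity
  have hlog : Real.log (2 * C / e) ≤ (2 * C / e) ^ 2 := by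
    have := Real.log_le_sub_one_of_pos hz
    nlinarith [sq_nonneg (2 * C / e - 1 / 2)]
  calc e * √((1 / H) * Real.log (2 * C / e)) ≤ e * √((1 / H) * (2 * C / e) ^ 2) := by gcongr
    _ = 2 * C / √H := by
        rw [Real.sqrt_mul (by positivity), Real.sqrt_sq hz.le, Real.sqrt_div zero_le_one,
          Real.sqrt_one]
        field_simp

/-- Rounding up costs at most a square: `exp (1 / H) + 1 ≤ exp (2 / H)`. -/
lemma exp_neg_two_le_inv_ceil_rpow {H : ℝ} (hH : 0 < H) (hH2 : H < 1 / 2) :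
    Real.exp (-2) ≤ (1 / (⌈Real.exp (1 / H)⌉₊ : ℝ)) ^ H := by
  have h1 : (⌈Real.exp (1 / H)⌉₊ : ℝ) ≤ Real.exp (2 / H) := by
    have h2 := (Nat.ceil_lt_add_one (Real.exp_pos (1 / H)).le).le
    have h3 : 2 ≤ Real.exp (1 / H) := by
      have h4 : 2 ≤ 1 / H := by
        rw [le_div_iff₀ hH]
        linarith
      linarith [Real.add_one_le_exp (1 / H)]
    have h5 : Real.exp (2 / H) = Real.exp (1 / H) * Real.exp (1 / H) := by
      rw [← Real.exp_add]
      ring_nf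
    nlinarith
  have h0 : (0 : ℝ) < ⌈Real.exp (1 / H)⌉₊ := by
    exact_mod_cast Nat.ceil_pos.2 (Real.exp_pos _)
  calc Real.exp (-2) = (1 / Real.exp (2 / H)) ^ H := by
        rw [one_div, ← Real.exp_neg, ← Real.exp_mul]
        congr 1
        field_simp
    _ ≤ _ := by gcongr

theorem theorem4 :
    ∃ c : ℝ, 0 < c ∧
      ∀ (d : ℕ) (A : Matrix (Fin d) (Fin d) ℝ) (ξ : EuclideanSpace ℝ (Fin d))
        (i₀ : Fin d) (C₁ : ℝ), 0 < C₁ → C₁ < 1 →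
        (∀ t ∈ Icc (0 : ℝ) 1, -1 + C₁ ≤ (NormedSpace.exp (t • A) * A) i₀ i₀) →
      ∀ H : ℝ, 0 < H → H < 1 / 2 →
      ∀ (Ω : Type*) [MeasurableSpace Ω] (P : Measure Ω) [IsProbabilityMeasure P]
        (B X : ℝ → Ω → EuclideanSpace ℝ (Fin d)),
        IsFractionalBrownianMotionVec H 1 B P →
        IsFractionalOU 1 A ξ B X P →
        (∀ t ∈ Icc (0 : ℝ) 1, Integrable (X t) P) ∧
        ENNReal.ofReal (c * Real.exp (-(1 / 2)) *
            √((1 / H) * Real.log (2 * C₁ / Real.exp (-(1 / 2)))))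
          ≤ ∫⁻ ω, ⨆ t ∈ Icc (0 : ℝ) 1, ‖X t ω - ∫ ω', X t ω' ∂P‖ₑ ∂P := by
  have he1 : Real.exp (-(1 / 2)) < 1 := by
    rw [← Real.exp_zero]
    exact Real.exp_lt_exp.2 (by norm_num)
  -- The factors bound `N ^ (-H)`, the probability of a large maximum, and the ratio of `C / √2 * (1
  -- / (2 * √H))` to `2 * C / √H`, using `√2 ≤ 2`.
  refine ⟨Real.exp (-2) * (1 - Real.exp (-(1 / 2))) / 8,
    by have := sub_pos.2 he1; positivity, ?_⟩
  intro d A ξ i₀ C hC hC1 hA H hH hH2 Ω _ P _ B X hB hX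
  refine ⟨fun t ht ↦ hX.integrable hB hH ht, ?_⟩
  set e := Real.exp (-(1 / 2)) with he
  set N := ⌈Real.exp (1 / H)⌉₊ with hN
  have hN0 : 0 < N := Nat.ceil_pos.2 (Real.exp_pos _)
  have hNr : (0 : ℝ) < N := by exact_mod_cast hN0
  set δ := C / √2 * (1 / N) ^ H with hδ
  have hδ0 : 0 < δ := by positivity
  set r := δ * (1 / (2 * √H)) with hr
  have hr0 : 0 < r := by positivity
  let τ : ℕ → ℝ := fun i ↦ (i + 1 : ℕ) / N
  have hτ : ∀ i < N, τ i ∈ Icc (0 : ℝ) 1 := fun i hi ↦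
    IsFractionalBrownianMotion.div_mem_Icc hi
  -- Markov's inequality is applied to this finite maximum, which is a.e. measurable; the full
  -- supremum is only compared with it pointwise.
  let F : Ω → ENNReal := fun ω ↦ ⨆ i : Fin N, ‖X (τ i) ω - ∫ ω', X (τ i) ω' ∂P‖ₑ
  have hF : AEMeasurable F P := AEMeasurable.iSup fun i ↦
    ((hX.integrable hB hH (hτ i i.2)).sub (integrable_const _)).aestronglyMeasurable.enorm
  set S : Set Ω := {ω | ∀ i < N,
    |X ((i + 1 : ℕ) / N) ω i₀ - (∫ ω', X (τ i) ω' ∂P) i₀| < r} with hS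
  have hsmall : P S ≤ ENNReal.ofReal e := by
    refine (hX.measure_forall_abs_sub_lt_le hB hH hH2 hC hC1 hA hN0 hr0.le
      fun i ↦ (∫ ω', X (τ i) ω' ∂P) i₀).trans ?_
    rw [← hδ, hr, mul_div_cancel_left₀ _ hδ0.ne']
    exact gaussianReal_Iic_pow_ceil_le hH hH2
  have hcompl : Sᶜ ⊆ {ω | ENNReal.ofReal r ≤ F ω} := by
    intro ω hω
    have hω' : ¬ ∀ i < N,
      |X ((i + 1 : ℕ) / N) ω i₀ - (∫ ω', X (τ i) ω' ∂P) i₀| < r := hω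
    push Not at hω'
    obtain ⟨i, hi, hir⟩ := hω'
    refine le_trans ?_ (le_iSup (fun i : Fin N ↦ ‖X (τ i) ω - ∫ ω', X (τ i) ω' ∂P‖ₑ) ⟨i, hi⟩)
    rw [← ofReal_norm]
    refine ENNReal.ofReal_le_ofReal (hir.trans ?_)
    exact PiLp.norm_apply_le (X (τ i) ω - ∫ ω', X (τ i) ω' ∂P) i₀
  have hbig : ENNReal.ofReal (1 - e) ≤ P {ω | ENNReal.ofReal r ≤ F ω} := by
    have h1 : (1 : ENNReal) ≤ P S + P Sᶜ := by
      rw [← measure_univ (μ := P), ← union_compl_self S]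
      exact measure_union_le _ _
    rw [ENNReal.ofReal_sub _ (Real.exp_pos _).le, ENNReal.ofReal_one]
    refine (tsub_le_iff_left.2 (h1.trans ?_)).trans (measure_mono hcompl)
    gcongr
  have hreal : Real.exp (-2) * (1 - e) / 8 * e * √((1 / H) * Real.log (2 * C / e))
      ≤ r * (1 - e) := by
    have h1 := exp_mul_sqrt_log_le hC hH
    have h2 := exp_neg_two_le_inv_ceil_rpow hH hH2
    have h3 : √2 ≤ 2 := by
      rw [Real.sqrt_le_left (by norm_num)]
      norm_num
    have h4 : 0 ≤ 1 - e := by linarith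
    calc Real.exp (-2) * (1 - e) / 8 * e * √((1 / H) * Real.log (2 * C / e))
        = Real.exp (-2) * (1 - e) / 8 * (e * √((1 / H) * Real.log (2 * C / e))) := by ring
      _ ≤ Real.exp (-2) * (1 - e) / 8 * (2 * C / √H) := by gcongr
      _ = C / 2 * Real.exp (-2) * (1 / (2 * √H)) * (1 - e) := by ring
      _ ≤ C / √2 * (1 / N) ^ H * (1 / (2 * √H)) * (1 - e) := by gcongr
      _ = r * (1 - e) := by rw [hr, hδ]
  calc _ ≤ ENNReal.ofReal (r * (1 - e)) := ENNReal.ofReal_le_ofReal hreal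
    _ = ENNReal.ofReal r * ENNReal.ofReal (1 - e) := ENNReal.ofReal_mul hr0.le
    _ ≤ ENNReal.ofReal r * P {ω | ENNReal.ofReal r ≤ F ω} := by gcongr
    _ ≤ ∫⁻ ω, F ω ∂P := mul_meas_ge_le_lintegral₀ hF _
    _ ≤ _ := lintegral_mono fun ω ↦ iSup_le fun i ↦
        le_iSup₂_of_le (τ i) (hτ i i.2) le_rfl
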